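/- Manifolds are smooth, real, finite-dimensional, without boundary; $M$ is Hausdorff and $\sigma$-compact. A group bundle is a smooth submersion $\pi\colon\mathfrak G\to M$ of manifolds together with a group structure on each fibre $\mathfrak G_x=\pi^{-1}(x)$ such that the multiplication $\mathfrak m\colon\mathfrak G\times_M\mathfrak G\to\mathfrak G$, the inversion $\mathfrak G\to\mathfrak G$ and the identity section $\mathfrak e\colon M\to\mathfrak G$ are smooth. It is locally trivial if every $x\in M$ has an open neighbourhood $U$ with a fibre preserving diffeomorphism $\mathfrak G|_U\to U\times\mathfrak G_x$ that restricts to a Lie group isomorphism $\mathfrak G_y\to\mathfrak G_x$ for each $y\in U$. Put $\mathrm{Lie}(\mathfrak G)_x=\ker(d\pi)_{\mathfrak e_x}=T_{\mathfrak e_x}(\mathfrak G_x)$, and let $\mathrm{Adj}_g$ be the differential at $\mathfrak e_x$ of $h\mapsto ghg^{-1}$ on $\mathfrak G_x$. A $1$-jet $j^1_xs$ of a local section $s$ is identified with the linear map $d_xs\colon T_xM\to T_{s(x)}\mathfrak G$; the jets at $x$ form a group under $j^1_xs\cdot j^1_xt=j^1_x(s\cdot t)$. A connection is a smooth section $\sigma$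 of $\pi_{1,0}\colon J^1\mathfrak G\to\mathfrak G$, that is, a smooth family of linear maps $\sigma(g)\colon T_{\pi(g)}M\to T_g\mathfrak G$ with $d_g\pi\circ\sigma(g)=\mathrm{id}$. It is a group connection if $\sigma$ is a morphism of group bundles: $\sigma(gh)=\sigma(g)\cdot\sigma(h)$ whenever $\pi(g)=\pi(h)$. Let $\mathcal Z^1(\mathfrak G_x,\mathrm{Lie}(\mathfrak G_x))$ be the vector space of smooth maps $\gamma\colon\mathfrak G_x\to\mathrm{Lie}(\mathfrak G)_x$ with $\gamma(gh)=\mathrm{Adj}_g(\gamma(h))+\gamma(g)$, and let $\Omega^1(M,\mathcal Z^1(\mathfrak G,\mathrm{Lie}(\mathfrak G)))$ be the vector space of families $\theta$ of linear maps $\theta_x\colon T_xM\to\mathcal Z^1(\mathfrak G_x,\mathrm{Lie}(\mathfrak G_x))$, $x\in M$, such that $\theta(g):=\big(v\mapsto\theta_{\pi(g)}(v)(g)\big)$, a linear map $T_{\pi(g)}M\to\mathrm{Lie}(\mathfrak G)_{\pi(g)}$, depends smoothly on $g\in\mathfrak G$. **Theorem.** Let $\pi\colon\mathfrak G\to M$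 be a locally trivial group bundle. The set of group connections on $\mathfrak G$ is a (nonempty) affine space modeled on the vector space $\Omega^1(M,\mathcal Z^1(\mathfrak G,\mathrm{Lie}(\mathfrak G)))$. Here, for $g\in\mathfrak G_x$, the translate $\theta+\sigma$ of a group connection $\sigma$ by $\theta$ is given by $(\theta+\sigma)(g)=(d_x\mathfrak e+\theta(g))\cdot\sigma(g)$ (product of jets), and the difference of group connections $\sigma,\tilde\sigma$ is the form $\theta=\sigma-\tilde\sigma$ given by $\theta(g)=\sigma(g)\cdot\tilde\sigma(g)^{-1}-d_x\mathfrak e$. -/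

import Mathlib

open scoped Manifold ContDiff Topology

noncomputable section

/-! Smooth manifolds (real, finite-dimensional, without boundary) are charted spaces over a
finite-dimensional normed space `E`, with the model `𝓘(ℝ, E)` and smoothness `∞`.
Smoothness of maps on fibred products and on fibres, which are embedded submanifolds, is
`ContMDiffOn` on the corresponding subsets of the ambient manifold. -/

/-- A map of sets `G → M` together with a group structure on each fibre. -/
structure FibrewiseGroup (M G : Type*) where
  proj : G → M
  group : ∀ x : M, Group {g : G // proj g = x}

namespace FibrewiseGroup

variable {M G : Type*} (B : FibrewiseGroup M G)

/-- The fibre over `x`. -/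
abbrev Fiber (x : M) : Type _ := {g : G // B.proj g = x}

instance (x : M) : Group (B.Fiber x) := B.group x

/-- A point of the total space, seen in its own fibre. -/
abbrev toFiber (g : G) : B.Fiber (B.proj g) := ⟨g, rfl⟩

/-- The fibred product of the total space with itself, as a subset of the product. -/
def fiberProduct : Set (G × G) := {p | B.proj p.1 = B.proj p.2}

open Classical in
/-- The multiplication. Only its values on the fibred product are meaningful (the value elsewhere
is irrelevant). -/
def mul (p : G × G) : G :=
  if h : B.proj p.2 = B.proj p.1 then ((B.toFiber p.1 * ⟨p.2, h⟩ : B.Fiber (B.proj p.1)) : G)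
  else p.1

/-- The inversion on the total space. -/
def inv (g : G) : G := ((B.toFiber g)⁻¹ : B.Fiber (B.proj g))

/-- The identity section. -/
def one (x : M) : G := (1 : B.Fiber x)

/-- The inner automorphism `h ↦ g * h * g⁻¹` of the fibre of `g`, as a map on the total space
(its values outside of the fibre are irrelevant). -/
def conj {x : M} (g : B.Fiber x) : G → G :=
  Function.extend Subtype.val (fun h : B.Fiber x ↦ ((g * h * g⁻¹ : B.Fiber x) : G)) id

theorem mul_coe {x : M} (g h : B.Fiber x) : B.mul ((g : G), (h : G)) = (g * h : B.Fiber x) := by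
  obtain ⟨g, rfl⟩ := g
  simp [mul, h.2]

end FibrewiseGroup

section Smooth

variable {EM EG : Type*} [NormedAddCommGroup EM] [NormedSpace ℝ EM]
  [NormedAddCommGroup EG] [NormedSpace ℝ EG]
  {M : Type*} [TopologicalSpace M] [ChartedSpace EM M] [IsManifold 𝓘(ℝ, EM) ∞ M]
  {G : Type*} [TopologicalSpace G] [ChartedSpace EG G] [IsManifold 𝓘(ℝ, EG) ∞ G]

variable (EM EG M G) in
/-- A (smooth) group bundle: a Lie groupoid whose source and target maps are the same submersion
`proj : G → M`. -/
structure GroupBundle extends FibrewiseGroup M G where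
  submersion : Manifold.IsSubmersion 𝓘(ℝ, EG) 𝓘(ℝ, EM) ∞ proj
  smooth_mul : ContMDiffOn (𝓘(ℝ, EG).prod 𝓘(ℝ, EG)) 𝓘(ℝ, EG) ∞
    toFibrewiseGroup.mul toFibrewiseGroup.fiberProduct
  smooth_inv : ContMDiff 𝓘(ℝ, EG) 𝓘(ℝ, EG) ∞ toFibrewiseGroup.inv
  smooth_one : ContMDiff 𝓘(ℝ, EM) 𝓘(ℝ, EG) ∞ toFibrewiseGroup.one

namespace GroupBundle

variable (B : GroupBundle EM EG M G)

/-- Local triviality as a group bundle: each `x` has an open neighbourhood `U` and a fibre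
preserving diffeomorphism of `proj ⁻¹' U` onto `U × Fiber x` given by group isomorphisms
`φ y : Fiber y ≃* Fiber x`. The maps `Φ` and `Ψ` are the fibre component of this diffeomorphism and
its inverse. -/
def IsLocallyTrivial : Prop :=
  ∀ x : M, ∃ U : Set M, IsOpen U ∧ x ∈ U ∧
    ∃ (φ : ∀ y : U, B.Fiber (y : M) ≃* B.Fiber x) (Φ : G → G) (Ψ : M × G → G),
      (∀ (y : U) (g : B.Fiber (y : M)), Φ g = φ y g) ∧
      (∀ (y : U) (h : B.Fiber x), Ψ ((y : M), (h : G)) = (φ y).symm h) ∧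
      ContMDiffOn 𝓘(ℝ, EG) 𝓘(ℝ, EG) ∞ Φ (B.proj ⁻¹' U) ∧
      ContMDiffOn (𝓘(ℝ, EM).prod 𝓘(ℝ, EG)) 𝓘(ℝ, EG) ∞ Ψ (U ×ˢ (B.proj ⁻¹' {x}))

/-- The tangent space of the base at `x`. -/
abbrev TBase (_B : GroupBundle EM EG M G) (x : M) : Type _ := TangentSpace 𝓘(ℝ, EM) x

/-- The tangent space of the total space at `g`. -/
abbrev TTot (_B : GroupBundle EM EG M G) (g : G) : Type _ := TangentSpace 𝓘(ℝ, EG) g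

/-- The vector of the model space underlying a tangent vector. It serves to compare tangent vectors
at points that are equal only up to a proof, such as `1 * g` and `g`. -/
def vec (B : GroupBundle EM EG M G) {g : G} (v : B.TTot g) : EG := v

/-- The differential of the projection at a point `g` over `x`. -/
def dproj {x : M} (g : B.Fiber x) : B.TTot (g : G) →L[ℝ] B.TBase x :=
  mfderiv 𝓘(ℝ, EG) 𝓘(ℝ, EM) B.proj (g : G)

/-- The differential of the identity section at `x`, i.e. the jet `j¹ₓ e`. -/
def jetOne (x : M) : B.TBase x →L[ℝ] B.TTot ((1 : B.Fiber x) : G) :=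
  mfderiv 𝓘(ℝ, EM) 𝓘(ℝ, EG) B.one x

/-- The product of `1`-jets over `x`. A `1`-jet `j¹ₓ s` of a local section is identified with the
linear section `dₓ s` of the differential of the projection, and `j¹ₓ s * j¹ₓ t = j¹ₓ (s * t)`
becomes composition with the differential of the multiplication `G ×_M G → G`
(see `jetMul_mfderiv`). -/
def jetMul {x : M} (g h : B.Fiber x) (φ : B.TBase x →L[ℝ] B.TTot (g : G))
    (ψ : B.TBase x →L[ℝ] B.TTot (h : G)) :
    B.TBase x →L[ℝ] B.TTot ((g * h : B.Fiber x) : G) :=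
  (mfderivWithin (𝓘(ℝ, EG).prod 𝓘(ℝ, EG)) 𝓘(ℝ, EG) B.mul B.fiberProduct ((g : G), (h : G)) :
    EG × EG →L[ℝ] EG).comp (ContinuousLinearMap.prod (φ : EM →L[ℝ] EG) (ψ : EM →L[ℝ] EG))

/-- The inverse of a `1`-jet over `x`: `(j¹ₓ s)⁻¹ = j¹ₓ (s⁻¹)`. -/
def jetInv {x : M} (g : B.Fiber x) (φ : B.TBase x →L[ℝ] B.TTot (g : G)) :
    B.TBase x →L[ℝ] B.TTot ((g⁻¹ : B.Fiber x) : G) :=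
  (mfderiv 𝓘(ℝ, EG) 𝓘(ℝ, EG) B.inv (g : G) : EG →L[ℝ] EG).comp (φ : EM →L[ℝ] EG)

/-- `j¹ₓ s * j¹ₓ t = j¹ₓ (s * t)` for local sections `s`, `t` near `x`. -/
theorem jetMul_mfderiv {x : M} {s t : M → G}
    (hs : ∀ᶠ y in 𝓝 x, B.proj (s y) = y) (ht : ∀ᶠ y in 𝓝 x, B.proj (t y) = y)
    (hsx : B.proj (s x) = x) (htx : B.proj (t x) = x)
    (hs' : MDifferentiableAt 𝓘(ℝ, EM) 𝓘(ℝ, EG) s x)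
    (ht' : MDifferentiableAt 𝓘(ℝ, EM) 𝓘(ℝ, EG) t x) :
    B.jetMul ⟨s x, hsx⟩ ⟨t x, htx⟩ (mfderiv 𝓘(ℝ, EM) 𝓘(ℝ, EG) s x)
      (mfderiv 𝓘(ℝ, EM) 𝓘(ℝ, EG) t x) =
      (mfderiv 𝓘(ℝ, EM) 𝓘(ℝ, EG) (fun y ↦ B.mul (s y, t y)) x : EM →L[ℝ] EG) := by
  have hm := ((B.smooth_mul (s x, t x) (hsx.trans htx.symm)).mdifferentiableWithinAt
    (by simp)).hasMFDerivWithinAt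
  have hst := (hs'.hasMFDerivAt.prodMk ht'.hasMFDerivAt)
  have hmem : {y | (s y, t y) ∈ B.fiberProduct} ∈ 𝓝 x := by
    filter_upwards [hs, ht] with y h1 h2 using h1.trans h2.symm
  have hc := hm.comp x (hst.hasMFDerivWithinAt (s := {y | (s y, t y) ∈ B.fiberProduct}))
    (fun y hy ↦ hy)
  exact (hc.hasMFDerivAt hmem).mfderiv.symm

/-- The Lie algebra bundle: `Lie(G)ₓ = ker (d proj)` at the identity `eₓ`, which is the tangent
space at `eₓ` of the fibre over `x`. -/
def LieAlg (x : M) : Submodule ℝ (B.TTot ((1 : B.Fiber x) : G)) :=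
  LinearMap.ker (B.dproj (1 : B.Fiber x) : B.TTot ((1 : B.Fiber x) : G) →ₗ[ℝ] B.TBase x)

/-- The adjoint action of `g` on the Lie algebra of its fibre: the differential at the identity of
the inner automorphism `h ↦ g * h * g⁻¹` of the fibre. It is meaningful only on vectors tangent
to the fibre. -/
def Ad {x : M} (g : B.Fiber x) :
    B.TTot ((1 : B.Fiber x) : G) →L[ℝ] B.TTot ((1 : B.Fiber x) : G) :=
  (mfderivWithin 𝓘(ℝ, EG) 𝓘(ℝ, EG) (B.conj g) (B.proj ⁻¹' {x}) ((1 : B.Fiber x) : G) :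
    EG →L[ℝ] EG)

/-- Smoothness of a map from the fibre over `x` to its Lie algebra. -/
def SmoothOnFiber {x : M} (γ : B.Fiber x → B.LieAlg x) : Prop :=
  ContMDiffOn 𝓘(ℝ, EG) 𝓘(ℝ, EG) ∞
    (Function.extend Subtype.val (fun g : B.Fiber x ↦ B.vec (γ g).1) (fun _ ↦ 0))
    (B.proj ⁻¹' {x})

/-- The vector space of smooth `1`-cocycles of the fibre over `x` with values in its Lie algebra
(with the adjoint action). -/
def Cocycle (x : M) : Submodule ℝ (B.Fiber x → B.LieAlg x) where
  carrier := {γ | B.SmoothOnFiber γ ∧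
    ∀ g h, (γ (g * h) : B.TTot ((1 : B.Fiber x) : G)) = B.Ad g (γ h) + γ g}
  add_mem' := by
    rintro γ δ ⟨h1, h2⟩ ⟨h3, h4⟩
    refine ⟨(ContMDiffOn.add h1 h3).congr fun g hg ↦ ?_, fun g h ↦ ?_⟩
    · obtain ⟨g, rfl⟩ : ∃ g' : B.Fiber x, g'.1 = g := ⟨⟨g, hg⟩, rfl⟩
      simp only [Pi.add_apply, Subtype.val_injective.extend_apply]
      rfl
    · simp only [Pi.add_apply, Submodule.coe_add, map_add, h2, h4]
      abel
  zero_mem' := by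
    refine ⟨(contMDiffOn_const (c := (0 : EG))).congr fun g hg ↦ ?_, fun g h ↦ by simp⟩
    obtain ⟨g, rfl⟩ : ∃ g' : B.Fiber x, g'.1 = g := ⟨⟨g, hg⟩, rfl⟩
    simp only [Subtype.val_injective.extend_apply]
    rfl
  smul_mem' := by
    rintro c γ ⟨h1, h2⟩
    refine ⟨((contDiff_const_smul c).contMDiff.comp_contMDiffOn h1).congr fun g hg ↦ ?_, fun g h ↦ ?_⟩
    · obtain ⟨g, rfl⟩ : ∃ g' : B.Fiber x, g'.1 = g := ⟨⟨g, hg⟩, rfl⟩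
      simp only [Pi.smul_apply, Function.comp_apply, Subtype.val_injective.extend_apply]
      rfl
    · simp only [Pi.smul_apply, Submodule.coe_smul, map_smul, h2, smul_add]

/-- Smoothness of a family of linear maps `σ g : T_{f g} M → T_{k g} G` indexed by `g : G`, i.e. of
a section of `Hom(f^* TM, k^* TG)`, read in the charts around each point. -/
def SmoothHom (f : G → M) (k : G → G)
    (σ : ∀ g : G, TangentSpace 𝓘(ℝ, EM) (f g) →L[ℝ] TangentSpace 𝓘(ℝ, EG) (k g)) : Prop :=
  ∀ g₀ : G, ContMDiffAt 𝓘(ℝ, EG) 𝓘(ℝ, EM →L[ℝ] EG) ∞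
    (inTangentCoordinates 𝓘(ℝ, EM) 𝓘(ℝ, EG) f k (fun g ↦ (σ g : EM →L[ℝ] EG)) g₀) g₀

/-- A connection, as a smooth section `σ` of the `1`-jet bundle over the total space; the
horizontal space at `g` is the range of `σ x g`. -/
@[ext]
structure Connection where
  toFun : ∀ (x : M) (g : B.Fiber x), B.TBase x →L[ℝ] B.TTot (g : G)
  isSection : ∀ (x : M) (g : B.Fiber x) (v : B.TBase x), B.dproj g (toFun x g v) = v
  smooth : SmoothHom B.proj id (fun g ↦ toFun (B.proj g) (B.toFiber g))

/-- The jet section of the connection is a morphism of group bundles. -/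
def Connection.IsGroup {B : GroupBundle EM EG M G} (σ : B.Connection) : Prop :=
  ∀ (x : M) (g h : B.Fiber x), σ.toFun x (g * h) = B.jetMul g h (σ.toFun x g) (σ.toFun x h)

/-- The space of group connections. -/
def GroupConnection : Type _ := {σ : B.Connection // σ.IsGroup}

instance : CoeFun B.GroupConnection
    (fun _ ↦ ∀ (x : M) (g : B.Fiber x), B.TBase x →L[ℝ] B.TTot (g : G)) :=
  ⟨fun σ ↦ σ.1.toFun⟩

variable [FiniteDimensional ℝ EM]

instance (x : M) : FiniteDimensional ℝ (B.TBase x) := inferInstanceAs (FiniteDimensional ℝ EM)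
instance (x : M) : T2Space (B.TBase x) := inferInstanceAs (T2Space EM)

/-- For `θ : TₓM → Cocycle x`, the linear map `v ↦ θ(v)(g)` from `TₓM` to `Lie(G)ₓ ⊆ T_{eₓ} G`. -/
def evalAt {x : M} (θ : B.TBase x →ₗ[ℝ] B.Cocycle x) (g : B.Fiber x) :
    B.TBase x →L[ℝ] B.TTot ((1 : B.Fiber x) : G) :=
  LinearMap.toContinuousLinearMap
    ((B.LieAlg x).subtype ∘ₗ LinearMap.proj g ∘ₗ (B.Cocycle x).subtype ∘ₗ θ)

instance : AddCommGroup (∀ x : M, B.TBase x →ₗ[ℝ] B.Cocycle x) := Pi.addCommGroup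
instance : Module ℝ (∀ x : M, B.TBase x →ₗ[ℝ] B.Cocycle x) := Pi.module _ _ _

/-- The vector space `Ω¹(M, Z¹(G, Lie G))` of `1`-forms `θ` on the base with values in the smooth
cocycles of the fibres, where `θ` is smooth in the sense that `g ↦ (v ↦ θ(v)(g))` is a smooth
section of `Hom(TM, Lie G)` along `proj : G → M`. -/
def CocycleForm : Submodule ℝ (∀ x : M, B.TBase x →ₗ[ℝ] B.Cocycle x) where
  carrier := {θ | SmoothHom B.proj (fun g ↦ B.one (B.proj g))
    (fun g ↦ B.evalAt (θ (B.proj g)) (B.toFiber g))}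
  add_mem' := by
    intro θ η h1 h2 g₀
    refine ((h1 g₀).add (h2 g₀)).congr_of_eventuallyEq (.of_forall fun g ↦ ?_)
    ext v
    exact map_add ((trivializationAt EG (TangentSpace 𝓘(ℝ, EG))
      (B.one (B.proj g₀))).continuousLinearMapAt ℝ (B.one (B.proj g))) _ _
  zero_mem' := by
    intro g₀
    refine (contMDiffAt_const (c := (0 : EM →L[ℝ] EG))).congr_of_eventuallyEq
      (.of_forall fun g ↦ ?_)
    ext v
    exact map_zero ((trivializationAt EG (TangentSpace 𝓘(ℝ, EG))
      (B.one (B.proj g₀))).continuousLinearMapAt ℝ (B.one (B.proj g)))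
  smul_mem' := by
    intro c θ h1 g₀
    refine ((contDiff_const_smul c).contMDiff.contMDiffAt.comp g₀ (h1 g₀)).congr_of_eventuallyEq (.of_forall fun g ↦ ?_)
    ext v
    exact map_smul ((trivializationAt EG (TangentSpace 𝓘(ℝ, EG))
      (B.one (B.proj g₀))).continuousLinearMapAt ℝ (B.one (B.proj g))) c _

end GroupBundle

end Smooth

end

/-! The 1-jets of local sections at `x` form a group `Jet x` that projects to the fibre, and a group
connection is a smooth family of homomorphisms from the fibres to these groups that split the
projection. The kernel of the projection consists of the jets `d_x e + u` with `u` a linear map from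
`T_x M` to `Lie(G)_x`. Multiplying such jets adds the maps `u` (`Jet.ofLie_mul_ofLie`), and
conjugating by any jet over `g` applies `Ad g` to `u` (`AdModel_comp_eq`). As for any group
extension with abelian kernel, two splittings differ by a unique 1-cocycle, so the affine identities
become cancellations in `Jet x`.

For smoothness, multiplying a jet over `g` on the left by `d_x e + u` adds the right translate of
`u` by `g` (`Jet.ofLie_mul`). It is therefore enough that right translations of vertical vectors
extend locally to smooth families of linear maps (`exists_smooth_extension_drmul`).

For existence, a local trivialization gives a flat group connection over its domain. The equation
`σ(gh) = dm(σ(g), σ(h))` is linear in `σ`, so it survives averaging by a partition of unity on the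
base, as does being a section of the projection, because the weights sum to one. -/

open scoped Manifold ContDiff Topology

noncomputable section

set_option linter.unusedSectionVars false

/-! ### Submersions: transport between fibres and lifting with prescribed derivative -/

section Submersion

variable {EM EG : Type*} [NormedAddCommGroup EM] [NormedSpace ℝ EM]
  [NormedAddCommGroup EG] [NormedSpace ℝ EG]
  {M : Type*} [TopologicalSpace M] [ChartedSpace EM M] [IsManifold 𝓘(ℝ, EM) ∞ M]
  {G : Type*} [TopologicalSpace G] [ChartedSpace EG G] [IsManifold 𝓘(ℝ, EG) ∞ G]

/-- Near a point `g₀`, a submersion `f` admits a smooth way `Λ` of moving points of the total space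
into prescribed fibres: `Λ (y, a)` is in the fibre over `y`, and `Λ (f a, a) = a`. -/
theorem Manifold.IsSubmersionAt.exists_fiber_transport {f : G → M} {g₀ : G}
    (h : Manifold.IsSubmersionAt 𝓘(ℝ, EG) 𝓘(ℝ, EM) ∞ f g₀) :
    ∃ Λ : M × G → G,
      ContMDiffAt (𝓘(ℝ, EM).prod 𝓘(ℝ, EG)) 𝓘(ℝ, EG) ∞ Λ (f g₀, g₀) ∧
      (∀ᶠ a in 𝓝 g₀, Λ (f a, a) = a) ∧ ∀ᶠ p in 𝓝 (f g₀, g₀), f (Λ p) = p.1 := by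
  set D := h.domChart with hD
  set C := h.codChart with hC
  have hw : ∀ z ∈ D.target, C (f (D.symm z)) = (h.equiv z).1 := by
    intro z hz
    have hz' : z ∈ (h.domChart.extend 𝓘(ℝ, EG)).target := by simpa using hz
    simpa using h.writtenInCharts hz'
  have hg₀ : g₀ ∈ D.source := h.mem_domChart_source
  have hfg₀ : f g₀ ∈ C.source := h.mem_codChart_source
  have hw' : ∀ a ∈ D.source, C (f a) = (h.equiv (D a)).1 := by
    intro a ha
    rw [← hw _ (D.map_source ha), D.left_inv ha]
  -- In the normal form of a submersion `f` is the first projection: overwrite the base coordinate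
  -- by that of `p.1` and keep the complementary coordinate of `p.2`.
  let Z : M × G → EG := fun p ↦ h.equiv.symm (C p.1, (h.equiv (D p.2)).2)
  have hZ : ∀ a ∈ D.source, Z (f a, a) = D a := by
    intro a ha
    simp [Z, hw' a ha]
  have hCs : ContMDiffAt 𝓘(ℝ, EM) 𝓘(ℝ, EM) ∞ C (f g₀) :=
    contMDiffAt_of_mem_maximalAtlas h.codChart_mem_maximalAtlas hfg₀
  have hDs : ContMDiffAt 𝓘(ℝ, EG) 𝓘(ℝ, EG) ∞ D g₀ :=
    contMDiffAt_of_mem_maximalAtlas h.domChart_mem_maximalAtlas hg₀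
  have hZs : ContMDiffAt (𝓘(ℝ, EM).prod 𝓘(ℝ, EG)) 𝓘(ℝ, EG) ∞ Z (f g₀, g₀) := by
    have h1 : ContMDiffAt (𝓘(ℝ, EM).prod 𝓘(ℝ, EG)) 𝓘(ℝ, EM) ∞
        (fun p : M × G ↦ C p.1) (f g₀, g₀) :=
      ContMDiffAt.comp (f g₀, g₀) (g := C) (by exact hCs) contMDiffAt_fst
    have h2 : ContMDiffAt (𝓘(ℝ, EM).prod 𝓘(ℝ, EG)) 𝓘(ℝ, h.complement) ∞
        (fun p : M × G ↦ (h.equiv (D p.2)).2) (f g₀, g₀) := by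
      have h3 : ContMDiffAt (𝓘(ℝ, EM).prod 𝓘(ℝ, EG)) 𝓘(ℝ, EG) ∞
          (fun p : M × G ↦ D p.2) (f g₀, g₀) :=
        ContMDiffAt.comp (f g₀, g₀) (g := D) (by exact hDs) contMDiffAt_snd
      have h4 : ContDiff ℝ ∞ (fun z : EG ↦ (h.equiv z).2) :=
        contDiff_snd.comp h.equiv.contDiff
      exact h4.contMDiff.contMDiffAt.comp (f g₀, g₀) h3
    exact h.equiv.symm.contDiff.contMDiff.contMDiffAt.comp (f g₀, g₀) (h1.prodMk_space h2)
  have hDt : D g₀ ∈ D.target := D.map_source hg₀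
  refine ⟨fun p ↦ D.symm (Z p), ?_, ?_, ?_⟩
  · refine ContMDiffAt.comp (f g₀, g₀) (g := D.symm) ?_ hZs
    rw [hZ _ hg₀]
    exact (contMDiffOn_symm_of_mem_maximalAtlas h.domChart_mem_maximalAtlas).contMDiffAt
      (D.open_target.mem_nhds hDt)
  · filter_upwards [D.open_source.mem_nhds hg₀] with a ha
    rw [hZ a ha, D.left_inv ha]
  · have e1 : ∀ᶠ p in 𝓝 (f g₀, g₀), Z p ∈ D.target :=
      hZs.continuousAt.eventually_mem (D.open_target.mem_nhds (by rw [hZ _ hg₀]; exact hDt))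
    have e2 : ∀ᶠ p in 𝓝 (f g₀, g₀), p.1 ∈ C.source :=
      continuousAt_fst.eventually_mem (C.open_source.mem_nhds hfg₀)
    filter_upwards [e1, e2] with p hp1 hp2
    refine C.injOn (h.source_subset_preimage_source (D.map_target hp1)) hp2 ?_
    rw [hw _ hp1]
    simp [Z]

/-- A map `a` into the base of a submersion lifts through any given tangential lift. -/
theorem Manifold.IsSubmersionAt.exists_lift
    {E' N : Type*} [NormedAddCommGroup E'] [NormedSpace ℝ E'] [TopologicalSpace N]
    [ChartedSpace E' N] [IsManifold 𝓘(ℝ, E') ∞ N]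
    {f : G → M} {g₀ : G} (h : Manifold.IsSubmersionAt 𝓘(ℝ, EG) 𝓘(ℝ, EM) ∞ f g₀)
    {a : N → M} {n : N} {a' : E' →L[ℝ] EM} (han : a n = f g₀)
    (ha : HasMFDerivAt 𝓘(ℝ, E') 𝓘(ℝ, EM) a n a') (φ : E' →L[ℝ] EG)
    (hφ : (mfderiv 𝓘(ℝ, EG) 𝓘(ℝ, EM) f g₀ : EG →L[ℝ] EM).comp φ = a') :
    ∃ c : N → G, c n = g₀ ∧ HasMFDerivAt 𝓘(ℝ, E') 𝓘(ℝ, EG) c n φ ∧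
      ∀ᶠ y in 𝓝 n, f (c y) = a y := by
  obtain ⟨Λ, hΛ, hΛ1, hΛ2⟩ := h.exists_fiber_transport
  -- A map with the right value and derivative, affine in charts, that ignores the fibres.
  obtain ⟨c₀, hc₀n, hc₀⟩ : ∃ c : N → G, c n = g₀ ∧ HasMFDerivAt 𝓘(ℝ, E') 𝓘(ℝ, EG) c n φ := by
    let χ := extChartAt 𝓘(ℝ, E') n
    let ψ := extChartAt 𝓘(ℝ, EG) g₀
    let L : E' → EG := fun z ↦ ψ g₀ + φ (z - χ n)
    have hL : HasFDerivAt L φ (χ n) := by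
      have := φ.hasFDerivAt.comp (χ n) ((hasFDerivAt_id (𝕜 := ℝ) (χ n)).sub_const (χ n))
      exact this.const_add (ψ g₀)
    have hLn : L (χ n) = ψ g₀ := by simp [L]
    have h1 : HasMFDerivAt 𝓘(ℝ, E') 𝓘(ℝ, E') χ n (ContinuousLinearMap.id ℝ E') := by
      have := (mdifferentiableAt_extChartAt (I := 𝓘(ℝ, E')) (x := n)
        (mem_chart_source E' n)).hasMFDerivAt
      rwa [mfderiv_extChartAt_self] at this
    have h2 : HasMFDerivAt 𝓘(ℝ, EG) 𝓘(ℝ, EG) ψ.symm (ψ g₀) (ContinuousLinearMap.id ℝ EG) := by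
      have := (mdifferentiableWithinAt_extChartAt_symm (I := 𝓘(ℝ, EG)) (x := g₀)
        (mem_extChartAt_target g₀)).hasMFDerivWithinAt
      rw [mfderivWithin_range_extChartAt_symm] at this
      rw [modelWithCornersSelf_coe, Set.range_id] at this
      exact hasMFDerivWithinAt_univ.mp this
    refine ⟨fun y ↦ ψ.symm (L (χ y)), by simp [hLn, ψ], ?_⟩
    rw [← hLn] at h2
    exact HasMFDerivAt.comp n h2 (hL.hasMFDerivAt.comp n h1)
  have hf : MDifferentiableAt 𝓘(ℝ, EG) 𝓘(ℝ, EM) f g₀ :=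
    h.contMDiffAt.mdifferentiableAt (by simp)
  have hΛd := (hΛ.mdifferentiableAt (by simp)).hasMFDerivAt
  set D := mfderiv (𝓘(ℝ, EM).prod 𝓘(ℝ, EG)) 𝓘(ℝ, EG) Λ (f g₀, g₀) with hD
  -- Differentiate the identity `Λ (f a, a) = a` at `g₀`.
  have hfa : ∀ w : EG, D ((mfderiv 𝓘(ℝ, EG) 𝓘(ℝ, EM) f g₀ w : EM), w) = w := by
    intro w
    have h1 := HasMFDerivAt.comp (f := fun a ↦ (f a, a)) g₀ hΛd
      (hf.hasMFDerivAt.prodMk (hasMFDerivAt_id g₀))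
    have h2 := (hasMFDerivAt_id (I := 𝓘(ℝ, EG)) g₀).congr_of_eventuallyEq hΛ1
    exact DFunLike.congr_fun (hasMFDerivAt_unique h1 h2) w
  have hpair : HasMFDerivAt 𝓘(ℝ, E') (𝓘(ℝ, EM).prod 𝓘(ℝ, EG)) (fun y ↦ (a y, c₀ y)) n
    (a'.prod φ) := ha.prodMk hc₀
  have hpt : (a n, c₀ n) = (f g₀, g₀) := by rw [han, hc₀n]
  -- `Λ` pushes `c₀` into the fibres prescribed by `a`. The derivative stays `φ` because `a' v` is
  -- the projection of `φ v`, so that `hfa` applies to the pair.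
  refine ⟨fun y ↦ Λ (a y, c₀ y), ?_, ?_, ?_⟩
  · simp only [hpt]
    exact hΛ1.self_of_nhds
  · rw [← hpt] at hΛd
    refine (HasMFDerivAt.comp n hΛd hpair).congr_mfderiv ?_
    ext v
    have := hfa (φ v)
    rw [show (mfderiv 𝓘(ℝ, EG) 𝓘(ℝ, EM) f g₀ (φ v) : EM) = a' v by rw [← hφ]; rfl] at this
    exact this
  · have hc : Filter.Tendsto (fun y ↦ (a y, c₀ y)) (𝓝 n) (𝓝 (f g₀, g₀)) := by
      rw [← hpt]
      exact hpair.continuousAt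
    exact hc.eventually hΛ2

end Submersion

/-! ### Differentials of the structure maps -/

namespace FibrewiseGroup

variable {M G : Type*} (B : FibrewiseGroup M G)

theorem inv_coe {x : M} (g : B.Fiber x) : B.inv (g : G) = (g⁻¹ : B.Fiber x) := by
  obtain ⟨g, rfl⟩ := g
  rfl

theorem proj_one (x : M) : B.proj (B.one x) = x := (1 : B.Fiber x).2

theorem conj_coe {x : M} (g h : B.Fiber x) :
    B.conj g (h : G) = ((g * h * g⁻¹ : B.Fiber x) : G) := by
  simp [conj]

end FibrewiseGroup

namespace GroupBundle

variable {EM EG : Type*} [NormedAddCommGroup EM] [NormedSpace ℝ EM]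
  [NormedAddCommGroup EG] [NormedSpace ℝ EG]
  {M : Type*} [TopologicalSpace M] [ChartedSpace EM M] [IsManifold 𝓘(ℝ, EM) ∞ M]
  {G : Type*} [TopologicalSpace G] [ChartedSpace EG G] [IsManifold 𝓘(ℝ, EG) ∞ G]
  {E' N : Type*} [NormedAddCommGroup E'] [NormedSpace ℝ E'] [TopologicalSpace N]
  [ChartedSpace E' N]

variable (B : GroupBundle EM EG M G)

/-- The differential of the multiplication on the fibred product, as a map of model spaces. It is
meaningful only on pairs of vectors with the same projection. -/
def dmul (g h : G) : EG × EG →L[ℝ] EG :=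
  (mfderivWithin (𝓘(ℝ, EG).prod 𝓘(ℝ, EG)) 𝓘(ℝ, EG) B.mul B.fiberProduct (g, h) :
    EG × EG →L[ℝ] EG)

/-- The differential of the inversion, as a map of model spaces. -/
def dinv (g : G) : EG →L[ℝ] EG := (mfderiv 𝓘(ℝ, EG) 𝓘(ℝ, EG) B.inv g : EG →L[ℝ] EG)

/-- The differential of the projection, as a map of model spaces. -/
def dprojModel (g : G) : EG →L[ℝ] EM :=
  (mfderiv 𝓘(ℝ, EG) 𝓘(ℝ, EM) B.proj g : EG →L[ℝ] EM)

/-- The differential of the identity section, as a map of model spaces. -/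
def done (x : M) : EM →L[ℝ] EG := (mfderiv 𝓘(ℝ, EM) 𝓘(ℝ, EG) B.one x : EM →L[ℝ] EG)

theorem hasMFDerivAt_proj (g : G) :
    HasMFDerivAt 𝓘(ℝ, EG) 𝓘(ℝ, EM) B.proj g (B.dprojModel g) :=
  (B.submersion.contMDiff.mdifferentiableAt (by simp)).hasMFDerivAt

theorem hasMFDerivAt_inv (g : G) : HasMFDerivAt 𝓘(ℝ, EG) 𝓘(ℝ, EG) B.inv g (B.dinv g) :=
  (B.smooth_inv.mdifferentiableAt (by simp)).hasMFDerivAt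

theorem hasMFDerivAt_one (x : M) : HasMFDerivAt 𝓘(ℝ, EM) 𝓘(ℝ, EG) B.one x (B.done x) :=
  (B.smooth_one.mdifferentiableAt (by simp)).hasMFDerivAt

variable {B} in
theorem hasMFDerivAt_mul {s t : N → G} {n : N} {s' t' : E' →L[ℝ] EG}
    (hs : HasMFDerivAt 𝓘(ℝ, E') 𝓘(ℝ, EG) s n s') (ht : HasMFDerivAt 𝓘(ℝ, E') 𝓘(ℝ, EG) t n t')
    (h : ∀ᶠ y in 𝓝 n, B.proj (s y) = B.proj (t y)) :
    HasMFDerivAt 𝓘(ℝ, E') 𝓘(ℝ, EG) (fun y ↦ B.mul (s y, t y)) n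
      ((B.dmul (s n) (t n)).comp (s'.prod t')) := by
  have hm := ((B.smooth_mul (s n, t n) h.self_of_nhds).mdifferentiableWithinAt
    (by simp)).hasMFDerivWithinAt
  have hst := hs.prodMk ht
  have hc := hm.comp n (hst.hasMFDerivWithinAt (s := {y | (s y, t y) ∈ B.fiberProduct}))
    (fun y hy ↦ hy)
  exact hc.hasMFDerivAt h

theorem exists_lift [IsManifold 𝓘(ℝ, E') ∞ N] {g₀ : G} {a : N → M} {n : N} {a' : E' →L[ℝ] EM}
    (han : a n = B.proj g₀) (ha : HasMFDerivAt 𝓘(ℝ, E') 𝓘(ℝ, EM) a n a') (φ : E' →L[ℝ] EG)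
    (hφ : (B.dprojModel g₀).comp φ = a') :
    ∃ c : N → G, c n = g₀ ∧ HasMFDerivAt 𝓘(ℝ, E') 𝓘(ℝ, EG) c n φ ∧
      ∀ᶠ y in 𝓝 n, B.proj (c y) = a y :=
  (B.submersion.isSubmersionAt g₀).exists_lift han ha φ hφ

/-- The derivative of a local section is a section of the derivative of the projection. -/
theorem dprojModel_comp_eq_of_lift {a : N → M} {c : N → G} {n : N} {a' : E' →L[ℝ] EM}
    {c' : E' →L[ℝ] EG} (ha : HasMFDerivAt 𝓘(ℝ, E') 𝓘(ℝ, EM) a n a')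
    (hc : HasMFDerivAt 𝓘(ℝ, E') 𝓘(ℝ, EG) c n c') (h : ∀ᶠ y in 𝓝 n, B.proj (c y) = a y) :
    (B.dprojModel (c n)).comp c' = a' :=
  hasMFDerivAt_unique (((B.hasMFDerivAt_proj (c n)).comp n hc).congr_of_eventuallyEq
    (h.mono fun _ hy ↦ hy.symm)) ha

/-! ### The group of 1-jets at a point -/

/-- The set of `1`-jets at `x` of local sections. -/
@[ext]
structure Jet (x : M) where
  pt : B.Fiber x
  lin : EM →L[ℝ] EG
  proj_lin : (B.dprojModel pt).comp lin = ContinuousLinearMap.id ℝ EM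

namespace Jet

variable {B} {x : M}

/-- `s` is a local section with `1`-jet `j`. -/
structure Represents (j : B.Jet x) (s : M → G) : Prop where
  eq : s x = j.pt
  hasMFDerivAt : HasMFDerivAt 𝓘(ℝ, EM) 𝓘(ℝ, EG) s x j.lin
  proj : ∀ᶠ y in 𝓝 x, B.proj (s y) = y

/-- Lift the identity of `M` along the submersion with derivative `j.lin`. Together with
`Represents.unique` this lets identities between jets be checked on local sections, where they are
identities in the fibres. -/
theorem exists_represents (j : B.Jet x) : ∃ s, j.Represents s := by
  obtain ⟨s, h1, h2, h3⟩ := B.exists_lift (a := id) (n := x) j.pt.2.symm (hasMFDerivAt_id x)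
    j.lin j.proj_lin
  exact ⟨s, h1, h2, h3⟩

theorem Represents.unique {j k : B.Jet x} {s t : M → G} (hs : j.Represents s)
    (ht : k.Represents t) (h : s =ᶠ[𝓝 x] t) : j = k := by
  refine Jet.ext (Subtype.ext ?_) ?_
  · rw [← hs.eq, ← ht.eq, h.self_of_nhds]
  · exact hasMFDerivAt_unique hs.hasMFDerivAt (ht.hasMFDerivAt.congr_of_eventuallyEq h)

theorem proj_lin_of_section {s : M → G} {φ : EM →L[ℝ] EG} (g : B.Fiber x) (hsx : s x = g)
    (hφ : HasMFDerivAt 𝓘(ℝ, EM) 𝓘(ℝ, EG) s x φ) (h : ∀ᶠ y in 𝓝 x, B.proj (s y) = y) :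
    (B.dprojModel g).comp φ = ContinuousLinearMap.id ℝ EM := by
  rw [← hsx]
  exact B.dprojModel_comp_eq_of_lift (hasMFDerivAt_id x) hφ h

instance : One (B.Jet x) :=
  ⟨1, B.done x, proj_lin_of_section (s := B.one) 1 rfl (B.hasMFDerivAt_one x)
    (.of_forall B.proj_one)⟩

theorem one_represents : (1 : B.Jet x).Represents B.one :=
  ⟨rfl, B.hasMFDerivAt_one x, .of_forall B.proj_one⟩

theorem proj_mul_section {s t : M → G} {y : M} (hs : B.proj (s y) = y) (ht : B.proj (t y) = y) :
    B.proj (B.mul (s y, t y)) = y := by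
  rw [show s y = ((⟨s y, hs⟩ : B.Fiber y) : G) from rfl,
    show t y = ((⟨t y, ht⟩ : B.Fiber y) : G) from rfl, B.mul_coe]
  exact (_ : B.Fiber y).2

theorem proj_inv_section {s : M → G} {y : M} (hs : B.proj (s y) = y) :
    B.proj (B.inv (s y)) = y := by
  rw [show s y = ((⟨s y, hs⟩ : B.Fiber y) : G) from rfl, B.inv_coe]
  exact (_ : B.Fiber y).2

theorem Represents.hasMFDerivAt_mul {j k : B.Jet x} {s t : M → G} (hs : j.Represents s)
    (ht : k.Represents t) : HasMFDerivAt 𝓘(ℝ, EM) 𝓘(ℝ, EG) (fun y ↦ B.mul (s y, t y)) x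
      ((B.dmul j.pt k.pt).comp (j.lin.prod k.lin)) := by
  rw [← hs.eq, ← ht.eq]
  refine GroupBundle.hasMFDerivAt_mul hs.hasMFDerivAt ht.hasMFDerivAt ?_
  filter_upwards [hs.proj, ht.proj] with y h1 h2 using h1.trans h2.symm

theorem Represents.hasMFDerivAt_inv {j : B.Jet x} {s : M → G} (hs : j.Represents s) :
    HasMFDerivAt 𝓘(ℝ, EM) 𝓘(ℝ, EG) (fun y ↦ B.inv (s y)) x ((B.dinv j.pt).comp j.lin) := by
  rw [← hs.eq]
  exact (B.hasMFDerivAt_inv (s x)).comp x hs.hasMFDerivAt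

theorem Represents.proj_mul {j k : B.Jet x} {s t : M → G} (hs : j.Represents s)
    (ht : k.Represents t) : ∀ᶠ y in 𝓝 x, B.proj (B.mul (s y, t y)) = y := by
  filter_upwards [hs.proj, ht.proj] with y h1 h2 using proj_mul_section h1 h2

theorem Represents.proj_inv {j : B.Jet x} {s : M → G} (hs : j.Represents s) :
    ∀ᶠ y in 𝓝 x, B.proj (B.inv (s y)) = y := by
  filter_upwards [hs.proj] with y h1 using proj_inv_section h1

theorem Represents.mul_eq {j k : B.Jet x} {s t : M → G} (hs : j.Represents s)
    (ht : k.Represents t) : B.mul (s x, t x) = (j.pt * k.pt : B.Fiber x) := by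
  rw [hs.eq, ht.eq, B.mul_coe]

theorem Represents.inv_eq {j : B.Jet x} {s : M → G} (hs : j.Represents s) :
    B.inv (s x) = (j.pt⁻¹ : B.Fiber x) := by
  rw [hs.eq, B.inv_coe]

instance : Mul (B.Jet x) where
  mul j k := ⟨j.pt * k.pt, (B.dmul j.pt k.pt).comp (j.lin.prod k.lin), by
    obtain ⟨s, hs⟩ := j.exists_represents
    obtain ⟨t, ht⟩ := k.exists_represents
    exact proj_lin_of_section _ (hs.mul_eq ht) (hs.hasMFDerivAt_mul ht) (hs.proj_mul ht)⟩

instance : Inv (B.Jet x) where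
  inv j := ⟨j.pt⁻¹, (B.dinv j.pt).comp j.lin, by
    obtain ⟨s, hs⟩ := j.exists_represents
    exact proj_lin_of_section _ hs.inv_eq hs.hasMFDerivAt_inv hs.proj_inv⟩

theorem pt_mul (j k : B.Jet x) : (j * k).pt = j.pt * k.pt := rfl

theorem pt_inv (j : B.Jet x) : j⁻¹.pt = j.pt⁻¹ := rfl

theorem lin_mul (j k : B.Jet x) :
    (j * k).lin = (B.dmul j.pt k.pt).comp (j.lin.prod k.lin) := rfl

theorem Represents.mul {j k : B.Jet x} {s t : M → G} (hs : j.Represents s)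
    (ht : k.Represents t) : (j * k).Represents fun y ↦ B.mul (s y, t y) :=
  ⟨hs.mul_eq ht, hs.hasMFDerivAt_mul ht, hs.proj_mul ht⟩

theorem Represents.inv {j : B.Jet x} {s : M → G} (hs : j.Represents s) :
    (j⁻¹).Represents fun y ↦ B.inv (s y) :=
  ⟨hs.inv_eq, hs.hasMFDerivAt_inv, hs.proj_inv⟩

/-- The group of `1`-jets of local sections at `x`. -/
instance : Group (B.Jet x) :=
  Group.ofLeftAxioms
    (fun j k l ↦ by
      obtain ⟨s, hs⟩ := j.exists_represents
      obtain ⟨t, ht⟩ := k.exists_represents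
      obtain ⟨u, hu⟩ := l.exists_represents
      refine ((hs.mul ht).mul hu).unique (hs.mul (ht.mul hu)) ?_
      filter_upwards [hs.proj, ht.proj, hu.proj] with y h1 h2 h3
      obtain ⟨a, ha⟩ : ∃ a : B.Fiber y, (a : G) = s y := ⟨⟨_, h1⟩, rfl⟩
      obtain ⟨b, hb⟩ : ∃ a : B.Fiber y, (a : G) = t y := ⟨⟨_, h2⟩, rfl⟩
      obtain ⟨c, hc⟩ : ∃ a : B.Fiber y, (a : G) = u y := ⟨⟨_, h3⟩, rfl⟩
      rw [← ha, ← hb, ← hc, B.mul_coe, B.mul_coe, B.mul_coe, B.mul_coe, mul_assoc])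
    (fun j ↦ by
      obtain ⟨s, hs⟩ := j.exists_represents
      refine (one_represents.mul hs).unique hs ?_
      filter_upwards [hs.proj] with y h1
      obtain ⟨a, ha⟩ : ∃ a : B.Fiber y, (a : G) = s y := ⟨⟨_, h1⟩, rfl⟩
      rw [← ha, FibrewiseGroup.one, B.mul_coe, one_mul])
    (fun j ↦ by
      obtain ⟨s, hs⟩ := j.exists_represents
      refine (hs.inv.mul hs).unique one_represents ?_
      filter_upwards [hs.proj] with y h1
      obtain ⟨a, ha⟩ : ∃ a : B.Fiber y, (a : G) = s y := ⟨⟨_, h1⟩, rfl⟩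
      rw [← ha, B.inv_coe, B.mul_coe, inv_mul_cancel]
      rfl)

end Jet

/-! ### Vertical perturbations of jets -/

/-- The right translation by `h` on vertical vectors at `g`, as a map of model spaces. -/
def drmul (g h : G) : EG →L[ℝ] EG := (B.dmul g h).comp (ContinuousLinearMap.inl ℝ EG EG)

namespace Jet

variable {B} {x : M}

/-- Two jets at the same point differ by a vertical linear map. -/
theorem dprojModel_sub {j k : B.Jet x} (h : j.pt = k.pt) :
    (B.dprojModel j.pt).comp (j.lin - k.lin) = 0 := by
  rw [ContinuousLinearMap.comp_sub, j.proj_lin, h, k.proj_lin, sub_self]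

/-- Translation of a jet by a vertical linear map. -/
def addVertical (j : B.Jet x) (u : EM →L[ℝ] EG) (hu : (B.dprojModel j.pt).comp u = 0) :
    B.Jet x :=
  ⟨j.pt, j.lin + u, by rw [ContinuousLinearMap.comp_add, hu, j.proj_lin, add_zero]⟩

/-- The differential of the multiplication is linear on pairs, and the pair of derivatives splits as
the unperturbed pair plus `(u, 0)`. -/
theorem addVertical_mul (j k : B.Jet x) (u : EM →L[ℝ] EG)
    (hu : (B.dprojModel j.pt).comp u = 0) :
    (j.addVertical u hu * k).lin = (j * k).lin + (B.drmul j.pt k.pt).comp u := by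
  ext v
  simp only [lin_mul, addVertical, drmul, ContinuousLinearMap.comp_apply,
    ContinuousLinearMap.prod_apply, add_apply, ContinuousLinearMap.inl_apply,
    ← map_add, Prod.mk_add_mk, add_zero]

/-- The jets over the identity that correspond to linear maps into the Lie algebra. -/
def ofLie (u : EM →L[ℝ] EG) (hu : (B.dprojModel (1 : B.Fiber x)).comp u = 0) : B.Jet x :=
  (1 : B.Jet x).addVertical u hu

theorem ofLie_mul (k : B.Jet x) (u : EM →L[ℝ] EG)
    (hu : (B.dprojModel (1 : B.Fiber x)).comp u = 0) :
    (ofLie u hu * k).lin = k.lin + (B.drmul (1 : B.Fiber x) k.pt).comp u := by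
  rw [ofLie, addVertical_mul, one_mul]
  rfl

/-- Right translation by the identity is the identity on the Lie algebra. -/
theorem drmul_one_comp (u : EM →L[ℝ] EG) (hu : (B.dprojModel (1 : B.Fiber x)).comp u = 0) :
    (B.drmul (1 : B.Fiber x) (1 : B.Fiber x)).comp u = u := by
  have h := ofLie_mul 1 u hu
  rw [mul_one] at h
  exact (add_left_cancel h).symm

/-- The kernel of the projection from jets to the fibre is an additive group: the left factor adds
its right translate by the identity, which is `u` itself. -/
theorem ofLie_mul_ofLie (u v : EM →L[ℝ] EG)
    (hu : (B.dprojModel (1 : B.Fiber x)).comp u = 0)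
    (hv : (B.dprojModel (1 : B.Fiber x)).comp v = 0) :
    ofLie u hu * ofLie v hv =
      ofLie (u + v) (by rw [ContinuousLinearMap.comp_add, hu, hv, add_zero]) := by
  refine Jet.ext (mul_one _) ?_
  rw [ofLie_mul]
  have : (B.drmul (1 : B.Fiber x) (ofLie v hv).pt).comp u = u := drmul_one_comp u hu
  rw [this]
  simp only [ofLie, addVertical]
  abel

theorem ofLie_zero : ofLie (0 : EM →L[ℝ] EG) (ContinuousLinearMap.comp_zero _) =
    (1 : B.Jet x) :=
  Jet.ext rfl (add_zero _)

end Jet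

end GroupBundle

/-! ### The adjoint action as conjugation of jets -/

namespace GroupBundle

variable {EM EG : Type*} [NormedAddCommGroup EM] [NormedSpace ℝ EM]
  [NormedAddCommGroup EG] [NormedSpace ℝ EG]
  {M : Type*} [TopologicalSpace M] [ChartedSpace EM M] [IsManifold 𝓘(ℝ, EM) ∞ M]
  {G : Type*} [TopologicalSpace G] [ChartedSpace EG G] [IsManifold 𝓘(ℝ, EG) ∞ G]
  {E' N : Type*} [NormedAddCommGroup E'] [NormedSpace ℝ E'] [TopologicalSpace N]
  [ChartedSpace E' N]
  {B : GroupBundle EM EG M G} {x : M}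

theorem contMDiffOn_conj (g : B.Fiber x) :
    ContMDiffOn 𝓘(ℝ, EG) 𝓘(ℝ, EG) ∞ (B.conj g) (B.proj ⁻¹' {x}) := by
  have h1 : ContMDiffOn 𝓘(ℝ, EG) 𝓘(ℝ, EG) ∞ (fun h : G ↦ B.mul ((g : G), h))
      (B.proj ⁻¹' {x}) :=
    B.smooth_mul.comp (contMDiffOn_const.prodMk contMDiffOn_id) fun h hh ↦ g.2.trans hh.symm
  have h2 : ContMDiffOn 𝓘(ℝ, EG) 𝓘(ℝ, EG) ∞
      (fun h : G ↦ B.mul (B.mul ((g : G), h), ((g⁻¹ : B.Fiber x) : G))) (B.proj ⁻¹' {x}) :=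
    B.smooth_mul.comp (h1.prodMk contMDiffOn_const) fun h hh ↦
      (Jet.proj_mul_section (s := fun _ ↦ (g : G)) (t := fun _ ↦ h) g.2 hh).trans
        (g⁻¹).2.symm
  refine h2.congr fun h hh ↦ ?_
  obtain ⟨h, rfl⟩ : ∃ k : B.Fiber x, (k : G) = h := ⟨⟨h, hh⟩, rfl⟩
  rw [B.conj_coe, B.mul_coe, B.mul_coe]

/-- The adjoint action, as a map of model spaces. -/
def AdModel (g : B.Fiber x) : EG →L[ℝ] EG := B.Ad g

theorem hasMFDerivAt_conj (g : B.Fiber x) {c : N → G} {n : N} {c' : E' →L[ℝ] EG}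
    (hcn : c n = (1 : B.Fiber x)) (hc : HasMFDerivAt 𝓘(ℝ, E') 𝓘(ℝ, EG) c n c')
    (h : ∀ᶠ y in 𝓝 n, B.proj (c y) = x) :
    HasMFDerivAt 𝓘(ℝ, E') 𝓘(ℝ, EG) (fun y ↦ B.conj g (c y)) n ((AdModel g).comp c') := by
  have hm := ((contMDiffOn_conj g _ (1 : B.Fiber x).2).mdifferentiableWithinAt
    (by simp)).hasMFDerivWithinAt
  rw [← hcn] at hm
  have hc := hm.comp n (hc.hasMFDerivWithinAt (s := {y | B.proj (c y) = x})) (fun y hy ↦ hy)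
  have := hc.hasMFDerivAt h
  rw [hcn] at this
  exact this

/-- Conjugation of a vertical jet over the identity is the adjoint action. -/
theorem AdModel_comp_eq (j : B.Jet x) (u : EM →L[ℝ] EG)
    (hu : (B.dprojModel (1 : B.Fiber x)).comp u = 0) :
    (B.dprojModel (1 : B.Fiber x)).comp ((AdModel j.pt).comp u) = 0 ∧
      (j * Jet.ofLie u hu * j⁻¹).lin = B.done x + (AdModel j.pt).comp u := by
  -- Lifting the constant map `x` realizes `u` by a map into the single fibre over `x`, where the
  -- inner automorphism makes sense.
  obtain ⟨c, hcx, hc, hcp⟩ := B.exists_lift (a := fun _ : M ↦ x) (n := x)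
    (g₀ := (1 : B.Fiber x)) (1 : B.Fiber x).2.symm (hasMFDerivAt_const x x) u hu
  have h1 := hasMFDerivAt_conj j.pt hcx hc hcp
  have hc1 : B.conj j.pt (c x) = (1 : B.Fiber x) := by
    rw [hcx, B.conj_coe, mul_one, mul_inv_cancel]
  have hm : ∀ y, B.proj (c y) = x → ∃ a : B.Fiber x, (a : G) = c y := fun y hy ↦ ⟨⟨c y, hy⟩, rfl⟩
  refine ⟨?_, ?_⟩
  · have := B.dprojModel_comp_eq_of_lift (hasMFDerivAt_const x x) h1 (by
      filter_upwards [hcp] with y hy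
      obtain ⟨a, ha⟩ := hm y hy
      rw [← ha, B.conj_coe]
      exact (_ : B.Fiber x).2)
    rwa [hc1] at this
  · have h2 := GroupBundle.hasMFDerivAt_mul (B := B) (hasMFDerivAt_const (j.pt : G) x) hc
      (hcp.mono fun y hy ↦ j.pt.2.trans hy.symm)
    have h3 := GroupBundle.hasMFDerivAt_mul (B := B) h2
      (hasMFDerivAt_const ((j.pt⁻¹ : B.Fiber x) : G) x) (by
        filter_upwards [hcp] with y hy
        obtain ⟨a, ha⟩ := hm y hy
        rw [← ha, B.mul_coe, (j.pt * a).2, (j.pt⁻¹).2])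
    have h4 := hasMFDerivAt_unique h1 (h3.congr_of_eventuallyEq (by
        filter_upwards [hcp] with y hy
        obtain ⟨a, ha⟩ := hm y hy
        rw [← ha, B.conj_coe, B.mul_coe, B.mul_coe]))
    rw [hcx, B.mul_coe, mul_one] at h4
    replace h4 : (AdModel j.pt).comp u = (B.dmul j.pt (j.pt⁻¹ : B.Fiber x)).comp
      (((B.dmul j.pt (1 : B.Fiber x)).comp ((0 : EM →L[ℝ] EG).prod u)).prod
        (0 : EM →L[ℝ] EG)) := h4
    -- Split the pair of derivatives into those of `j` and `1`, whose product is `j`, and `(0, u)`.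
    -- After multiplying by `j⁻¹` the first part gives the identity jet and the second gives `Ad`,
    -- so only the base point of `j` matters.
    have h5 : (j * Jet.ofLie u hu).lin =
        j.lin + (B.dmul j.pt (1 : B.Fiber x)).comp ((0 : EM →L[ℝ] EG).prod u) := by
      have h6 : j.lin = (j * 1).lin := by rw [mul_one]
      rw [h6, Jet.lin_mul, Jet.lin_mul]
      refine Eq.trans ?_ (ContinuousLinearMap.comp_add _ _ _)
      refine congrArg (B.dmul j.pt (1 : B.Fiber x)).comp ?_
      ext v
      · simp
      · rfl
    have h7 : (j * j⁻¹).lin = B.done x := by rw [mul_inv_cancel]; rfl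
    have h8 : (j * Jet.ofLie u hu).pt = j.pt := mul_one _
    rw [Jet.lin_mul, h5, h8, ← h7, h4, Jet.lin_mul]
    refine Eq.trans ?_ (ContinuousLinearMap.comp_add _ _ _)
    refine congrArg (B.dmul j.pt (j.pt⁻¹ : B.Fiber x)).comp ?_
    ext v
    · rfl
    · exact (add_zero _).symm

end GroupBundle

/-! ### Families of linear maps read in tangent coordinates -/

section InTangentCoordinates

variable {E E' E'' EN : Type*} [NormedAddCommGroup E] [NormedSpace ℝ E]
  [NormedAddCommGroup E'] [NormedSpace ℝ E'] [NormedAddCommGroup E''] [NormedSpace ℝ E'']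
  [NormedAddCommGroup EN] [NormedSpace ℝ EN]
  {X : Type*} [TopologicalSpace X] [ChartedSpace E X] [IsManifold 𝓘(ℝ, E) ∞ X]
  {X' : Type*} [TopologicalSpace X'] [ChartedSpace E' X'] [IsManifold 𝓘(ℝ, E') ∞ X']
  {X'' : Type*} [TopologicalSpace X''] [ChartedSpace E'' X''] [IsManifold 𝓘(ℝ, E'') ∞ X'']
  {N : Type*} [TopologicalSpace N] [ChartedSpace EN N]

/-- Used where points such as `1 * g` and `g` agree only propositionally, so that their tangent
spaces differ as types. -/
theorem inTangentCoordinates_congr {f f' : N → X} {k k' : N → X'} {ϕ ϕ' : N → E →L[ℝ] E'}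
    {n₀ n : N} (hf₀ : f n₀ = f' n₀) (hk₀ : k n₀ = k' n₀) (hf : f n = f' n) (hk : k n = k' n)
    (hϕ : ϕ n = ϕ' n) :
    inTangentCoordinates 𝓘(ℝ, E) 𝓘(ℝ, E') f k ϕ n₀ n =
      inTangentCoordinates 𝓘(ℝ, E) 𝓘(ℝ, E') f' k' ϕ' n₀ n := by
  have key : ∀ {a a' b b' : X} {c c' d d' : X'} {ψ ψ' : E →L[ℝ] E'}, a = a' → b = b' → c = c' →
      d = d' → ψ = ψ' →
      ContinuousLinearMap.inCoordinates E (TangentSpace 𝓘(ℝ, E)) E' (TangentSpace 𝓘(ℝ, E'))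
        a b c d ψ =
      ContinuousLinearMap.inCoordinates E (TangentSpace 𝓘(ℝ, E)) E' (TangentSpace 𝓘(ℝ, E'))
        a' b' c' d' ψ' := by
    rintro a _ b _ c _ d _ ψ _ rfl rfl rfl rfl rfl
    rfl
  exact key hf₀ hf hk₀ hk hϕ

theorem inTangentCoordinates_add (f : N → X) (k : N → X') (ϕ ψ : N → E →L[ℝ] E') (n₀ n : N) :
    inTangentCoordinates 𝓘(ℝ, E) 𝓘(ℝ, E') f k (fun n ↦ ϕ n + ψ n) n₀ n =
      inTangentCoordinates 𝓘(ℝ, E) 𝓘(ℝ, E') f k ϕ n₀ n +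
      inTangentCoordinates 𝓘(ℝ, E) 𝓘(ℝ, E') f k ψ n₀ n := by
  ext v
  exact map_add ((trivializationAt E' (TangentSpace 𝓘(ℝ, E')) (k n₀)).continuousLinearMapAt ℝ
    (k n)) _ _

theorem inTangentCoordinates_sub (f : N → X) (k : N → X') (ϕ ψ : N → E →L[ℝ] E') (n₀ n : N) :
    inTangentCoordinates 𝓘(ℝ, E) 𝓘(ℝ, E') f k (fun n ↦ ϕ n - ψ n) n₀ n =
      inTangentCoordinates 𝓘(ℝ, E) 𝓘(ℝ, E') f k ϕ n₀ n -
      inTangentCoordinates 𝓘(ℝ, E) 𝓘(ℝ, E') f k ψ n₀ n := by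
  ext v
  exact map_sub ((trivializationAt E' (TangentSpace 𝓘(ℝ, E')) (k n₀)).continuousLinearMapAt ℝ
    (k n)) _ _

theorem inTangentCoordinates_sum_smul {ι : Type*} (s : Finset ι) (f : N → X) (k : N → X')
    (r : ι → N → ℝ) (ϕ : ι → N → E →L[ℝ] E') (n₀ n : N) :
    inTangentCoordinates 𝓘(ℝ, E) 𝓘(ℝ, E') f k (fun n ↦ ∑ i ∈ s, r i n • ϕ i n) n₀ n =
      ∑ i ∈ s, r i n • inTangentCoordinates 𝓘(ℝ, E) 𝓘(ℝ, E') f k (ϕ i) n₀ n := by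
  let L : (E →L[ℝ] E') →ₗ[ℝ] (E →L[ℝ] E') :=
    { toFun := fun ψ ↦ ContinuousLinearMap.inCoordinates E (TangentSpace 𝓘(ℝ, E)) E'
        (TangentSpace 𝓘(ℝ, E')) (f n₀) (f n) (k n₀) (k n) ψ
      map_add' := fun a b ↦ inTangentCoordinates_add f k (fun _ ↦ a) (fun _ ↦ b) n₀ n
      map_smul' := fun c a ↦ by
        ext v
        exact map_smul ((trivializationAt E' (TangentSpace 𝓘(ℝ, E')) (k n₀)).continuousLinearMapAt
          ℝ (k n)) c _ }
  have : L (∑ i ∈ s, r i n • ϕ i n) = ∑ i ∈ s, r i n • L (ϕ i n) := by simp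
  exact this

/-- The two chart changes at the intermediate point `k n` cancel. -/
theorem inTangentCoordinates_comp {f : N → X} {k : N → X'} {l : N → X''} {n₀ n : N}
    (hf : f n ∈ (chartAt E (f n₀)).source) (hk : k n ∈ (chartAt E' (k n₀)).source)
    (hl : l n ∈ (chartAt E'' (l n₀)).source) (A : N → E' →L[ℝ] E'') (ϕ : N → E →L[ℝ] E') :
    inTangentCoordinates 𝓘(ℝ, E) 𝓘(ℝ, E'') f l (fun n ↦ (A n).comp (ϕ n)) n₀ n =
      (inTangentCoordinates 𝓘(ℝ, E') 𝓘(ℝ, E'') k l A n₀ n).comp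
        (inTangentCoordinates 𝓘(ℝ, E) 𝓘(ℝ, E') f k ϕ n₀ n) := by
  rw [inTangentCoordinates_eq _ _ _ hf hl, inTangentCoordinates_eq _ _ _ hf hk,
    inTangentCoordinates_eq _ _ _ hk hl]
  ext v
  simp only [ContinuousLinearMap.comp_apply]
  rw [VectorBundleCore.coordChange_comp, VectorBundleCore.coordChange_self]
  all_goals simp [hk]

/-- Each tangent space is identified with the model through the preferred chart at its own point, so
no chart change remains. -/
theorem inTangentCoordinates_self {f : N → X} {k : N → X'} {n₀ n : N} (hf : f n = f n₀)
    (hk : k n = k n₀) (ϕ : N → E →L[ℝ] E') :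
    inTangentCoordinates 𝓘(ℝ, E) 𝓘(ℝ, E') f k ϕ n₀ n = ϕ n := by
  rw [inTangentCoordinates_eq _ _ _ (by rw [hf]; exact mem_chart_source _ _)
    (by rw [hk]; exact mem_chart_source _ _)]
  ext v
  simp only [ContinuousLinearMap.comp_apply]
  rw [hf, hk, VectorBundleCore.coordChange_self, VectorBundleCore.coordChange_self]
  all_goals simp

theorem ContMDiffAt.inTangentCoordinates_comp {f : N → X} {k : N → X'} {l : N → X''} {n₀ : N}
    {A : N → E' →L[ℝ] E''} {ϕ : N → E →L[ℝ] E'}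
    (hA : ContMDiffAt 𝓘(ℝ, EN) 𝓘(ℝ, E' →L[ℝ] E'') ∞
      (inTangentCoordinates 𝓘(ℝ, E') 𝓘(ℝ, E'') k l A n₀) n₀)
    (hϕ : ContMDiffAt 𝓘(ℝ, EN) 𝓘(ℝ, E →L[ℝ] E') ∞
      (inTangentCoordinates 𝓘(ℝ, E) 𝓘(ℝ, E') f k ϕ n₀) n₀)
    (hf : ContinuousAt f n₀) (hk : ContinuousAt k n₀) (hl : ContinuousAt l n₀) :
    ContMDiffAt 𝓘(ℝ, EN) 𝓘(ℝ, E →L[ℝ] E'') ∞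
      (inTangentCoordinates 𝓘(ℝ, E) 𝓘(ℝ, E'') f l (fun n ↦ (A n).comp (ϕ n)) n₀) n₀ := by
  refine (hA.clm_comp hϕ).congr_of_eventuallyEq ?_
  filter_upwards [hf.eventually_mem (chart_source_mem_nhds E (f n₀)),
    hk.eventually_mem (chart_source_mem_nhds E' (k n₀)),
    hl.eventually_mem (chart_source_mem_nhds E'' (l n₀))] with n h1 h2 h3
  exact _root_.inTangentCoordinates_comp h1 h2 h3 A ϕ

end InTangentCoordinates

/-! ### Smooth dependence of right translations -/

namespace GroupBundle

variable {EM EG : Type*} [NormedAddCommGroup EM] [NormedSpace ℝ EM]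
  [NormedAddCommGroup EG] [NormedSpace ℝ EG]
  {M : Type*} [TopologicalSpace M] [ChartedSpace EM M] [IsManifold 𝓘(ℝ, EM) ∞ M]
  {G : Type*} [TopologicalSpace G] [ChartedSpace EG G] [IsManifold 𝓘(ℝ, EG) ∞ G]
  {B : GroupBundle EM EG M G}

/-- The derivative of right translations on vertical vectors extends locally to a smooth family of
linear maps. -/
theorem exists_smooth_extension_drmul {k l : G → G} (hk : ContMDiff 𝓘(ℝ, EG) 𝓘(ℝ, EG) ∞ k)
    (hl : ContMDiff 𝓘(ℝ, EG) 𝓘(ℝ, EG) ∞ l) (hkl : ∀ g, B.proj (k g) = B.proj (l g)) (g₀ : G) :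
    ∃ A : G → EG →L[ℝ] EG,
      ContMDiffAt 𝓘(ℝ, EG) 𝓘(ℝ, EG →L[ℝ] EG) ∞ (inTangentCoordinates 𝓘(ℝ, EG) 𝓘(ℝ, EG) k
        (fun g ↦ B.mul (k g, l g)) A g₀) g₀ ∧
      ∀ᶠ g in 𝓝 g₀, ∀ u, B.dprojModel (k g) u = 0 → A g u = B.drmul (k g) (l g) u := by
  obtain ⟨Λ, hΛ, hΛ1, hΛ2⟩ := (B.submersion.isSubmersionAt (k g₀)).exists_fiber_transport
  -- The multiplication can be differentiated only along the fibred product. Moving `a` into the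
  -- fibre of `k g` first makes the right translation meaningful on a full neighbourhood, so its
  -- derivative in `a` is a smooth family.
  let f : G → G → G := fun g a ↦ B.mul (Λ (B.proj (k g), a), l g)
  have hpk : ContMDiff 𝓘(ℝ, EG) 𝓘(ℝ, EM) ∞ (fun g ↦ B.proj (k g)) :=
    B.submersion.contMDiff.comp hk
  have hP : ContMDiff (𝓘(ℝ, EG).prod 𝓘(ℝ, EG)) (𝓘(ℝ, EM).prod 𝓘(ℝ, EG)) ∞
      (fun p : G × G ↦ (B.proj (k p.1), p.2)) :=
    (hpk.comp contMDiff_fst).prodMk contMDiff_snd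
  have hQ : ContMDiffAt (𝓘(ℝ, EG).prod 𝓘(ℝ, EG)) (𝓘(ℝ, EG).prod 𝓘(ℝ, EG)) ∞
      (fun p : G × G ↦ (Λ (B.proj (k p.1), p.2), l p.1)) (g₀, k g₀) :=
    (ContMDiffAt.comp (g₀, k g₀) (f := fun p : G × G ↦ (B.proj (k p.1), p.2)) hΛ
      hP.contMDiffAt).prodMk (hl.comp contMDiff_fst).contMDiffAt
  have hmem : ∀ᶠ p : G × G in 𝓝 (g₀, k g₀),
      (Λ (B.proj (k p.1), p.2), l p.1) ∈ B.fiberProduct := by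
    have := (hP.continuous.tendsto (g₀, k g₀)).eventually hΛ2
    filter_upwards [this] with p hp using hp.trans (hkl p.1)
  have hf : ContMDiffAt (𝓘(ℝ, EG).prod 𝓘(ℝ, EG)) 𝓘(ℝ, EG) ∞ (Function.uncurry f)
      (g₀, k g₀) :=
    ((B.smooth_mul _ hmem.self_of_nhds).comp (g₀, k g₀)
      (s := {p : G × G | (Λ (B.proj (k p.1), p.2), l p.1) ∈ B.fiberProduct})
      hQ.contMDiffWithinAt (fun p hp ↦ hp)).contMDiffAt hmem
  have hk1 := (hk.continuous.tendsto g₀).eventually hΛ1.eventually_nhds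
  refine ⟨fun g ↦ mfderiv 𝓘(ℝ, EG) 𝓘(ℝ, EG) (f g) (k g), ?_, ?_⟩
  · refine (ContMDiffAt.mfderiv f k hf hk.contMDiffAt (m := ∞) (by simp)).congr_of_eventuallyEq ?_
    filter_upwards [hk1] with g hg
    have e : ∀ g, (∀ᶠ a in 𝓝 (k g), Λ (B.proj a, a) = a) → B.mul (k g, l g) = f g (k g) := by
      intro g hg
      simp only [f, hg.self_of_nhds]
    exact inTangentCoordinates_congr rfl (e g₀ hΛ1) rfl (e g hg) rfl
  · have hf1 : ∀ᶠ p in 𝓝 (g₀, k g₀), ContMDiffAt (𝓘(ℝ, EG).prod 𝓘(ℝ, EG)) 𝓘(ℝ, EG) 1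
        (Function.uncurry f) p :=
      (contMDiffAt_iff_contMDiffAt_nhds (by simp)).1 (hf.of_le (by simp))
    have hf2 := ((continuous_id.prodMk hk.continuous).tendsto g₀).eventually hf1
    filter_upwards [hk1, hf2] with g hg hfg u hu
    have hfd : HasMFDerivAt 𝓘(ℝ, EG) 𝓘(ℝ, EG) (f g) (k g)
        (mfderiv 𝓘(ℝ, EG) 𝓘(ℝ, EG) (f g) (k g)) :=
      MDifferentiableAt.hasMFDerivAt (ContMDiffAt.mdifferentiableAt
        (ContMDiffAt.comp (k g) (f := fun a ↦ (g, a)) (g := Function.uncurry f) hfg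
          (contMDiffAt_const.prodMk contMDiffAt_id)) (n := 1) (by simp))
    -- A curve in the fibre of `k g` with velocity `u`: `Λ` fixes its points near `0`, so along it
    -- `f g` is the right translation.
    obtain ⟨c, hc0, hc, hcp⟩ := B.exists_lift (N := ℝ) (E' := ℝ) (n := 0)
      (g₀ := k g) (a := fun _ ↦ B.proj (k g)) rfl (hasMFDerivAt_const _ _)
      (ContinuousLinearMap.toSpanSingleton ℝ u) (by
        ext
        exact (congrArg (B.dprojModel (k g)) (one_smul ℝ u)).trans hu)
    have h1 := hasMFDerivAt_mul hc (hasMFDerivAt_const (l g) (0 : ℝ)) (B := B)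
      (hcp.mono fun y hy ↦ hy.trans (hkl g))
    rw [← hc0] at hfd
    have h2 := hfd.comp (0 : ℝ) hc
    have h3 := hasMFDerivAt_unique h1 (h2.congr_of_eventuallyEq (by
      have h4 := hc.continuousAt.eventually (hc0 ▸ hg)
      filter_upwards [hcp, h4] with t ht ht'
      simp only [f, Function.comp_apply]
      rw [← ht, ht']))
    have h5 : B.dmul (c 0) (l g) ((1 : ℝ) • u, 0) =
      mfderiv 𝓘(ℝ, EG) 𝓘(ℝ, EG) (f g) (c 0) ((1 : ℝ) • u) := DFunLike.congr_fun h3 (1 : ℝ)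
    rw [one_smul, hc0] at h5
    exact h5.symm

end GroupBundle

/-! ### Existence of group connections -/

namespace GroupBundle

variable {EM EG : Type*} [NormedAddCommGroup EM] [NormedSpace ℝ EM]
  [NormedAddCommGroup EG] [NormedSpace ℝ EG]
  {M : Type*} [TopologicalSpace M] [ChartedSpace EM M] [IsManifold 𝓘(ℝ, EM) ∞ M]
  {G : Type*} [TopologicalSpace G] [ChartedSpace EG G] [IsManifold 𝓘(ℝ, EG) ∞ G]
  {B : GroupBundle EM EG M G}

/-- Each trivialization induces a flat group connection over its domain. -/
theorem IsLocallyTrivial.exists_local_groupConnection (hB : B.IsLocallyTrivial) (x₀ : M) :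
    ∃ (U : Set M) (c : G → EM →L[ℝ] EG), IsOpen U ∧ x₀ ∈ U ∧
      (∀ g, B.proj g ∈ U → ContMDiffAt 𝓘(ℝ, EG) 𝓘(ℝ, EM →L[ℝ] EG) ∞
        (inTangentCoordinates 𝓘(ℝ, EM) 𝓘(ℝ, EG) B.proj id c g) g) ∧
      ∀ x ∈ U, ∃ J : B.Fiber x →ₙ* B.Jet x, ∀ g, (J g).pt = g ∧ (J g).lin = c g := by
  obtain ⟨U, hU, hxU, φ, Φ, Ψ, hΦ, hΨ, hΦs, hΨs⟩ := hB x₀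
  -- The section through `g` that is constant in the trivialization. Since the trivialization is by
  -- group isomorphisms, `s (g * h)` is the product of `s g` and `s h`, which makes its jet
  -- multiplicative.
  let s : G → M → G := fun g y ↦ Ψ (y, Φ g)
  have hΦm : ∀ (x : U) (g : B.Fiber (x : M)) (y : U),
      s g y = ((φ y).symm (φ x g) : B.Fiber (y : M)) := by
    intro x g y
    simp only [s]
    rw [hΦ x g, hΨ]
  have hs : ∀ g, B.proj g ∈ U → ContMDiffAt (𝓘(ℝ, EG).prod 𝓘(ℝ, EM)) 𝓘(ℝ, EG) ∞
      (Function.uncurry s) (g, B.proj g) := by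
    intro g hg
    have h1 : ContMDiffOn (𝓘(ℝ, EG).prod 𝓘(ℝ, EM)) (𝓘(ℝ, EM).prod 𝓘(ℝ, EG)) ∞
        (fun p : G × M ↦ (p.2, Φ p.1)) ((B.proj ⁻¹' U) ×ˢ U) :=
      contMDiffOn_snd.prodMk (hΦs.comp contMDiffOn_fst fun p hp ↦ hp.1)
    have h2 := hΨs.comp h1 (by
      rintro ⟨a, y⟩ ⟨ha, hy⟩
      refine ⟨hy, ?_⟩
      have := hΦ ⟨B.proj a, ha⟩ ⟨a, rfl⟩
      simp only [Set.mem_preimage, this]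
      exact (_ : B.Fiber x₀).2)
    exact h2.contMDiffAt (((hU.preimage B.submersion.contMDiff.continuous).prod hU).mem_nhds
      ⟨hg, hg⟩)
  have hrep : ∀ x ∈ U, ∀ g : B.Fiber x, s g x = g ∧ HasMFDerivAt 𝓘(ℝ, EM) 𝓘(ℝ, EG) (s g) x
      (mfderiv 𝓘(ℝ, EM) 𝓘(ℝ, EG) (s g) x) ∧ ∀ᶠ y in 𝓝 x, B.proj (s g y) = y := by
    intro x hx g
    refine ⟨?_, ?_, ?_⟩
    · rw [hΦm ⟨x, hx⟩ g ⟨x, hx⟩, MulEquiv.symm_apply_apply]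
    · have h := hs g (by rwa [g.2])
      rw [g.2] at h
      exact (ContMDiffAt.mdifferentiableAt (ContMDiffAt.comp x (f := fun y ↦ ((g : G), y))
        (g := Function.uncurry s) h (contMDiffAt_const.prodMk contMDiffAt_id))
        (n := ∞) (by simp)).hasMFDerivAt
    · filter_upwards [hU.mem_nhds hx] with y hy
      rw [hΦm ⟨x, hx⟩ g ⟨y, hy⟩]
      exact (_ : B.Fiber y).2
  refine ⟨U, fun g ↦ mfderiv 𝓘(ℝ, EM) 𝓘(ℝ, EG) (s g) (B.proj g), hU, hxU, ?_, ?_⟩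
  · intro g hg
    refine (ContMDiffAt.mfderiv s B.proj (hs g hg) B.submersion.contMDiff.contMDiffAt
      (m := ∞) (by simp)).congr_of_eventuallyEq ?_
    filter_upwards [(hU.preimage B.submersion.contMDiff.continuous).mem_nhds hg] with a ha
    exact inTangentCoordinates_congr rfl (hrep _ hg ⟨g, rfl⟩).1.symm rfl
      (hrep _ ha ⟨a, rfl⟩).1.symm rfl
  · intro x hx
    let J : B.Fiber x → B.Jet x := fun g ↦ ⟨g, mfderiv 𝓘(ℝ, EM) 𝓘(ℝ, EG) (s g) x,
      Jet.proj_lin_of_section g (hrep x hx g).1 (hrep x hx g).2.1 (hrep x hx g).2.2⟩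
    have hJ : ∀ g, (J g).Represents (s g) := fun g ↦
      ⟨(hrep x hx g).1, (hrep x hx g).2.1, (hrep x hx g).2.2⟩
    refine ⟨⟨J, fun g h ↦ (hJ _).unique ((hJ g).mul (hJ h)) ?_⟩, fun g ↦ ⟨rfl, ?_⟩⟩
    · filter_upwards [hU.mem_nhds hx] with y hy
      rw [hΦm ⟨x, hx⟩ _ ⟨y, hy⟩, hΦm ⟨x, hx⟩ _ ⟨y, hy⟩, hΦm ⟨x, hx⟩ _ ⟨y, hy⟩, B.mul_coe,
        map_mul, map_mul]
    · have : ∀ y, y = x → (mfderiv 𝓘(ℝ, EM) 𝓘(ℝ, EG) (s g) x : EM →L[ℝ] EG) =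
          mfderiv 𝓘(ℝ, EM) 𝓘(ℝ, EG) (s g) y := by
        rintro y rfl
        rfl
      exact this _ g.2

/-- The jet of a connection at a point. -/
def Connection.jet (σ : B.Connection) {x : M} (g : B.Fiber x) : B.Jet x :=
  ⟨g, σ.toFun x g, ContinuousLinearMap.ext (σ.isSection x g)⟩

/-- A group connection as a family of group homomorphisms. -/
def GroupConnection.jet (σ : B.GroupConnection) (x : M) : B.Fiber x →* B.Jet x :=
  MonoidHom.mk' σ.1.jet fun g h ↦ Jet.ext rfl (σ.2 x g h)

theorem IsLocallyTrivial.nonempty_groupConnection [FiniteDimensional ℝ EM] [T2Space M]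
    [SigmaCompactSpace M] (hB : B.IsLocallyTrivial) : Nonempty B.GroupConnection := by
  choose U c hU hxU hc hJ using hB.exists_local_groupConnection
  obtain ⟨f, hf⟩ := SmoothPartitionOfUnity.exists_isSubordinate 𝓘(ℝ, EM) isClosed_univ U hU
    (fun x _ ↦ Set.mem_iUnion.2 ⟨x, hxU x⟩)
  let σ : G → EM →L[ℝ] EG := fun g ↦ ∑ᶠ i, f i (B.proj g) • c i g
  have hσ : ∀ x, ∃ s : Finset M, ∀ᶠ y in 𝓝 x, ∑ i ∈ s, f i y = 1 ∧
      ∀ g, B.proj g = y → σ g = ∑ i ∈ s, f i y • c i g := by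
    intro x
    obtain ⟨s, hs⟩ := f.toPartitionOfUnity.exists_finset_nhds x
    refine ⟨s, hs.mono fun y hy ↦ ⟨hy.1, ?_⟩⟩
    rintro g rfl
    exact finsum_eq_sum_of_support_subset _
      ((Function.support_smul_subset_left _ _).trans hy.2)
  have hsum : ∀ x, ∃ s : Finset M, ∑ i ∈ s, f i x = 1 ∧
      ∀ g : B.Fiber x, σ g = ∑ i ∈ s, f i x • c i g := by
    intro x
    obtain ⟨s, hs⟩ := hσ x
    exact ⟨s, hs.self_of_nhds.1, fun g ↦ hs.self_of_nhds.2 g g.2⟩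
  -- The values of `c i` away from `U i` carry no information; there the weight is zero.
  have hU' : ∀ i x, f i x = 0 ∨ x ∈ U i := fun i x ↦ by
    by_contra! h
    exact h.2 (hf i (subset_tsupport _ h.1))
  let τ : B.Connection :=
    { toFun := fun x g ↦ σ g
      isSection := fun x g v ↦ by
        have : (B.dprojModel g).comp (σ g) = ContinuousLinearMap.id ℝ EM := by
          obtain ⟨s, hs1, hs⟩ := hsum x
          rw [hs, ContinuousLinearMap.comp_finsetSum,
            ← one_smul ℝ (ContinuousLinearMap.id ℝ EM), ← hs1, Finset.sum_smul]
          refine Finset.sum_congr rfl fun i _ ↦ ?_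
          rw [ContinuousLinearMap.comp_smul]
          obtain h | h := hU' i x
          · simp [h]
          · obtain ⟨J, hJ⟩ := hJ i x h
            have := (J g).proj_lin
            rw [(hJ g).1, (hJ g).2] at this
            rw [this]
        exact DFunLike.congr_fun this v
      smooth := fun g₀ ↦ by
        obtain ⟨s, hs⟩ := hσ (B.proj g₀)
        have hp : ContMDiff 𝓘(ℝ, EG) 𝓘(ℝ, EM) ∞ B.proj := B.submersion.contMDiff
        have h1 : ContMDiffAt 𝓘(ℝ, EG) 𝓘(ℝ, EM →L[ℝ] EG) ∞ (fun g ↦ ∑ i ∈ s, f i (B.proj g) •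
            inTangentCoordinates 𝓘(ℝ, EM) 𝓘(ℝ, EG) B.proj id (c i) g₀ g) g₀ := by
          refine ContMDiffAt.sum fun i _ ↦ ?_
          by_cases hi : B.proj g₀ ∈ U i
          · exact (((f i).contMDiff.comp hp).contMDiffAt).smul (hc i g₀ hi)
          · refine (contMDiffAt_const (c := (0 : EM →L[ℝ] EG))).congr_of_eventuallyEq ?_
            have h2 : B.proj g₀ ∉ tsupport (f i) := fun h ↦ hi (hf i h)
            have h3 := (hp.continuous.tendsto g₀).eventually
              (notMem_tsupport_iff_eventuallyEq.1 h2)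
            filter_upwards [h3] with g hg
            rw [hg]
            exact zero_smul _ _
        refine h1.congr_of_eventuallyEq ?_
        filter_upwards [(hp.continuous.tendsto g₀).eventually hs] with g hg
        refine Eq.trans ?_ (inTangentCoordinates_sum_smul s B.proj id
          (fun i g ↦ f i (B.proj g)) c g₀ g)
        exact inTangentCoordinates_congr rfl rfl rfl rfl (hg.2 g rfl) }
  refine ⟨τ, fun x g h ↦ ?_⟩
  obtain ⟨s, hs1, hs⟩ := hsum x
  have : σ (g * h : B.Fiber x) = (B.dmul g h).comp ((σ g).prod (σ h)) := by
    -- The weights depend only on `x`, so `σ g` and `σ h` are combined with the same coefficients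
    -- and the linear map `B.dmul g h` can be applied term by term.
    have hp : (σ g).prod (σ h) = ∑ i ∈ s, f i x • (c i g).prod (c i h) := by
      rw [hs, hs]
      ext v <;> simp [Prod.fst_sum, Prod.snd_sum]
    rw [hp, hs, ContinuousLinearMap.comp_finsetSum]
    refine Finset.sum_congr rfl fun i _ ↦ ?_
    rw [ContinuousLinearMap.comp_smul]
    obtain h' | h' := hU' i x
    · simp [h']
    · obtain ⟨J, hJ⟩ := hJ i x h'
      have := Jet.lin_mul (J g) (J h)
      rw [← map_mul, (hJ g).1, (hJ g).2, (hJ h).1, (hJ h).2, (hJ _).2] at this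
      rw [this]
  exact this

end GroupBundle

/-! ### Cocycle forms as families of vertical jets -/

namespace GroupBundle

variable {EM EG : Type*} [NormedAddCommGroup EM] [NormedSpace ℝ EM] [FiniteDimensional ℝ EM]
  [NormedAddCommGroup EG] [NormedSpace ℝ EG]
  {M : Type*} [TopologicalSpace M] [ChartedSpace EM M] [IsManifold 𝓘(ℝ, EM) ∞ M]
  {G : Type*} [TopologicalSpace G] [ChartedSpace EG G] [IsManifold 𝓘(ℝ, EG) ∞ G]
  {B : GroupBundle EM EG M G} {x : M}

namespace CocycleForm

/-- The value of a cocycle form at a point of the total space, as a map of model spaces. -/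
def eval (θ : B.CocycleForm) (g : B.Fiber x) : EM →L[ℝ] EG := B.evalAt (θ.1 x) g

theorem dprojModel_comp_eval (θ : B.CocycleForm) (g : B.Fiber x) :
    (B.dprojModel (1 : B.Fiber x)).comp (eval θ g) = 0 :=
  ContinuousLinearMap.ext fun v ↦ ((θ.1 x v).1 g).2

theorem eval_mul (θ : B.CocycleForm) (g h : B.Fiber x) :
    eval θ (g * h) = (AdModel g).comp (eval θ h) + eval θ g :=
  ContinuousLinearMap.ext fun v ↦ (θ.1 x v).2.2 g h

theorem ext_eval {θ η : B.CocycleForm} (h : ∀ (x : M) (g : B.Fiber x), eval θ g = eval η g) :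
    θ = η :=
  Subtype.ext <| funext fun x ↦ LinearMap.ext fun v ↦ Subtype.ext <| funext fun g ↦
    Subtype.ext <| DFunLike.congr_fun (h x g) v

/-- The jet over the identity corresponding to the value of a cocycle form. -/
def jet (θ : B.CocycleForm) (g : B.Fiber x) : B.Jet x :=
  Jet.ofLie (eval θ g) (dprojModel_comp_eval θ g)

/-- The cocycle identity in multiplicative form. The jet `j` over `g` is arbitrary, as conjugation
sees only `Ad g`; the later choice is `σ(g)`. -/
theorem jet_mul (θ : B.CocycleForm) (g h : B.Fiber x) (j : B.Jet x) (hj : j.pt = g) :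
    jet θ (g * h) = jet θ g * (j * jet θ h * j⁻¹) := by
  subst hj
  obtain ⟨h1, h2⟩ := AdModel_comp_eq j (eval θ h) (dprojModel_comp_eval θ h)
  have h3 : j * jet θ h * j⁻¹ = Jet.ofLie _ h1 :=
    Jet.ext (by
      rw [Jet.pt_mul, Jet.pt_mul, Jet.pt_inv, show (jet θ h).pt = 1 from rfl, mul_one,
        mul_inv_cancel]
      rfl) h2
  rw [h3, jet, jet, Jet.ofLie_mul_ofLie]
  simp only [eval_mul, add_comm]

theorem jet_add (θ η : B.CocycleForm) (g : B.Fiber x) :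
    jet (θ + η) g = jet θ g * jet η g := by
  rw [jet, jet, jet, Jet.ofLie_mul_ofLie]
  rfl

theorem jet_zero (g : B.Fiber x) : jet (0 : B.CocycleForm) g = 1 :=
  Jet.ofLie_zero

theorem smooth_eval (θ : B.CocycleForm) (g₀ : G) :
    ContMDiffAt 𝓘(ℝ, EG) 𝓘(ℝ, EM →L[ℝ] EG) ∞ (inTangentCoordinates 𝓘(ℝ, EM) 𝓘(ℝ, EG) B.proj
      (fun g ↦ B.one (B.proj g)) (fun g ↦ eval θ (B.toFiber g)) g₀) g₀ :=
  θ.2 g₀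

end CocycleForm

/-! ### The affine structure on group connections -/

namespace GroupConnection

theorem ext_jet {σ τ : B.GroupConnection} (h : ∀ (x : M) (g : B.Fiber x), σ.jet x g = τ.jet x g) :
    σ = τ :=
  Subtype.ext <| Connection.ext <| funext fun x ↦ funext fun g ↦ congrArg Jet.lin (h x g)

theorem smooth_jet (σ : B.GroupConnection) (g₀ : G) :
    ContMDiffAt 𝓘(ℝ, EG) 𝓘(ℝ, EM →L[ℝ] EG) ∞ (inTangentCoordinates 𝓘(ℝ, EM) 𝓘(ℝ, EG) B.proj
      id (fun g ↦ (σ.jet (B.proj g) (B.toFiber g)).lin) g₀) g₀ :=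
  σ.1.smooth g₀

/-- A smooth family of group homomorphisms into the groups of jets that is a section of the
projection gives a group connection. -/
def ofJet (J : ∀ x, B.Fiber x →* B.Jet x) (hJ : ∀ x g, (J x g).pt = g)
    (hs : ∀ g₀ : G, ContMDiffAt 𝓘(ℝ, EG) 𝓘(ℝ, EM →L[ℝ] EG) ∞
      (inTangentCoordinates 𝓘(ℝ, EM) 𝓘(ℝ, EG) B.proj id
        (fun g ↦ (J (B.proj g) (B.toFiber g)).lin) g₀) g₀) : B.GroupConnection :=
  ⟨{  toFun := fun x g ↦ (J x g).lin
      isSection := fun x g v ↦ by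
        have h := (J x g).proj_lin
        rw [hJ] at h
        exact DFunLike.congr_fun h v
      smooth := hs },
    fun x g h ↦ by
      have e := Jet.lin_mul (J x g) (J x h)
      rw [← map_mul, hJ, hJ] at e
      exact e⟩

theorem jet_ofJet (J : ∀ x, B.Fiber x →* B.Jet x) (hJ : ∀ x g, (J x g).pt = g) (hs)
    (x : M) (g : B.Fiber x) : (ofJet J hJ hs).jet x g = J x g :=
  Jet.ext (hJ x g).symm rfl

theorem lin_jet_mul_jet (θ : B.CocycleForm) (σ : B.GroupConnection) (g : B.Fiber x) :
    (CocycleForm.jet θ g * σ.jet x g).lin =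
      (σ.jet x g).lin + (B.drmul (1 : B.Fiber x) g).comp (CocycleForm.eval θ g) :=
  Jet.ofLie_mul _ _ _

/-- By `lin_jet_mul_jet` the product is `σ` plus the right translate of `θ`. The smooth extension of
right translations may replace `drmul` because `θ` takes vertical values. -/
theorem smooth_jet_mul_jet (θ : B.CocycleForm) (σ : B.GroupConnection) (g₀ : G) :
    ContMDiffAt 𝓘(ℝ, EG) 𝓘(ℝ, EM →L[ℝ] EG) ∞
      (inTangentCoordinates 𝓘(ℝ, EM) 𝓘(ℝ, EG) B.proj id
        (fun g ↦ (CocycleForm.jet θ (B.toFiber g) * σ.jet (B.proj g) (B.toFiber g)).lin) g₀) g₀ := by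
  have hp : ContMDiff 𝓘(ℝ, EG) 𝓘(ℝ, EM) ∞ B.proj := B.submersion.contMDiff
  have hk : ContMDiff 𝓘(ℝ, EG) 𝓘(ℝ, EG) ∞ (fun g ↦ B.one (B.proj g)) := B.smooth_one.comp hp
  obtain ⟨A, hA, hA'⟩ := exists_smooth_extension_drmul (B := B) hk contMDiff_id
    (fun g ↦ B.proj_one _) g₀
  have hm : (fun g ↦ B.mul (B.one (B.proj g), id g)) = id := by
    funext g
    exact (B.mul_coe 1 (B.toFiber g)).trans (by rw [one_mul]; rfl)
  rw [hm] at hA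
  refine ((σ.smooth_jet g₀).add (hA.inTangentCoordinates_comp (CocycleForm.smooth_eval θ g₀)
    hp.continuous.continuousAt hk.continuous.continuousAt
    continuousAt_id)).congr_of_eventuallyEq ?_
  filter_upwards [hA'] with g hg
  refine Eq.trans (inTangentCoordinates_congr rfl rfl rfl rfl ?_)
    (inTangentCoordinates_add B.proj id _ _ g₀ g)
  rw [lin_jet_mul_jet]
  congr 1
  ext v
  exact (hg _ (DFunLike.congr_fun (CocycleForm.dprojModel_comp_eval θ (B.toFiber g)) v)).symm

/-- Translation of a group connection by a cocycle form. -/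
def translate (θ : B.CocycleForm) (σ : B.GroupConnection) : B.GroupConnection :=
  ofJet (fun x ↦ MonoidHom.mk' (fun g ↦ CocycleForm.jet θ g * σ.jet x g) fun g h ↦ by
    -- With `σ(g)` as the conjugating jet, its inverse cancels against the first factor of `σ(gh) =
    -- σ(g) σ(h)`.
    rw [CocycleForm.jet_mul θ g h (σ.jet x g) rfl, map_mul]
    group)
    (fun x g ↦ one_mul g) (smooth_jet_mul_jet θ σ)

theorem jet_translate (θ : B.CocycleForm) (σ : B.GroupConnection) (g : B.Fiber x) :
    (translate θ σ).jet x g = CocycleForm.jet θ g * σ.jet x g := jet_ofJet _ _ _ _ _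

/-- The difference of two group connections at a point of the total space. -/
def diff (σ τ : B.GroupConnection) (g : B.Fiber x) : EM →L[ℝ] EG :=
  (σ.jet x g * (τ.jet x g)⁻¹).lin - B.done x

theorem dprojModel_comp_diff (σ τ : B.GroupConnection) (g : B.Fiber x) :
    (B.dprojModel (1 : B.Fiber x)).comp (diff σ τ g) = 0 := by
  have h : (σ.jet x g * (τ.jet x g)⁻¹).pt = 1 := mul_inv_cancel g
  have := Jet.dprojModel_sub (k := 1) h
  rwa [h] at this

theorem ofLie_diff (σ τ : B.GroupConnection) (g : B.Fiber x) :
    Jet.ofLie (diff σ τ g) (dprojModel_comp_diff σ τ g) = σ.jet x g * (τ.jet x g)⁻¹ :=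
  Jet.ext (mul_inv_cancel g).symm (add_sub_cancel _ _)

/-- In the jet group, `σ(gh) τ(gh)⁻¹ = (σ(g) (σ(h) τ(h)⁻¹) σ(g)⁻¹) (σ(g) τ(g)⁻¹)`, and the first
factor is an adjoint action. -/
theorem diff_mul (σ τ : B.GroupConnection) (g h : B.Fiber x) :
    diff σ τ (g * h) = (AdModel g).comp (diff σ τ h) + diff σ τ g := by
  obtain ⟨h1, h2⟩ := AdModel_comp_eq (σ.jet x g) (diff σ τ h) (dprojModel_comp_diff σ τ h)
  have h3 : σ.jet x g * Jet.ofLie (diff σ τ h) (dprojModel_comp_diff σ τ h) * (σ.jet x g)⁻¹ =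
      Jet.ofLie _ h1 := by
    refine Jet.ext ?_ h2
    rw [ofLie_diff]
    change g * (h * h⁻¹) * g⁻¹ = 1
    group
  have h4 : Jet.ofLie _ (dprojModel_comp_diff σ τ (g * h)) =
      Jet.ofLie _ h1 * Jet.ofLie _ (dprojModel_comp_diff σ τ g) := by
    rw [← h3, ofLie_diff, ofLie_diff, ofLie_diff, map_mul, map_mul]
    group
  rw [Jet.ofLie_mul_ofLie] at h4
  exact add_left_cancel (congrArg Jet.lin h4)

/-- Write `σ` as `τ` plus a vertical map and multiply by `τ⁻¹`. This removes the jet inverse, so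
smoothness of the difference reduces to that of right translation by `g⁻¹`. -/
theorem diff_eq_drmul_comp (σ τ : B.GroupConnection) (g : B.Fiber x) :
    diff σ τ g = (B.drmul g (g⁻¹ : B.Fiber x)).comp ((σ.jet x g).lin - (τ.jet x g).lin) := by
  have h1 : (B.dprojModel (τ.jet x g).pt).comp ((σ.jet x g).lin - (τ.jet x g).lin) = 0 :=
    Jet.dprojModel_sub (j := σ.jet x g) (k := τ.jet x g) rfl
  have h2 : σ.jet x g = (τ.jet x g).addVertical _ h1 :=
    Jet.ext rfl (add_sub_cancel _ _).symm
  have h3 := Jet.addVertical_mul (τ.jet x g) (τ.jet x g)⁻¹ _ h1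
  rw [← h2, mul_inv_cancel] at h3
  rw [diff, h3]
  exact add_sub_cancel_left _ _

theorem smooth_diff (σ τ : B.GroupConnection) (g₀ : G) :
    ContMDiffAt 𝓘(ℝ, EG) 𝓘(ℝ, EM →L[ℝ] EG) ∞ (inTangentCoordinates 𝓘(ℝ, EM) 𝓘(ℝ, EG) B.proj
      (fun g ↦ B.one (B.proj g)) (fun g ↦ diff σ τ (B.toFiber g)) g₀) g₀ := by
  have hp : ContMDiff 𝓘(ℝ, EG) 𝓘(ℝ, EM) ∞ B.proj := B.submersion.contMDiff
  have hl : ContMDiff 𝓘(ℝ, EG) 𝓘(ℝ, EG) ∞ (fun g ↦ B.one (B.proj g)) := B.smooth_one.comp hp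
  obtain ⟨A, hA, hA'⟩ := exists_smooth_extension_drmul (B := B) contMDiff_id B.smooth_inv
    (fun g ↦ ((B.toFiber g)⁻¹).2.symm) g₀
  have hm : (fun g ↦ B.mul (id g, B.inv g)) = fun g ↦ B.one (B.proj g) := by
    funext g
    exact (B.mul_coe (B.toFiber g) (B.toFiber g)⁻¹).trans (by rw [mul_inv_cancel]; rfl)
  rw [hm] at hA
  have hd : ContMDiffAt 𝓘(ℝ, EG) 𝓘(ℝ, EM →L[ℝ] EG) ∞
      (inTangentCoordinates 𝓘(ℝ, EM) 𝓘(ℝ, EG) B.proj id (fun g ↦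
        (σ.jet (B.proj g) (B.toFiber g)).lin - (τ.jet (B.proj g) (B.toFiber g)).lin) g₀) g₀ :=
    ((σ.smooth_jet g₀).sub (τ.smooth_jet g₀)).congr_of_eventuallyEq
      (.of_forall fun g ↦ inTangentCoordinates_sub _ _ _ _ _ _)
  refine (hA.inTangentCoordinates_comp hd hp.continuous.continuousAt continuousAt_id
    hl.continuous.continuousAt).congr_of_eventuallyEq ?_
  filter_upwards [hA'] with g hg
  refine inTangentCoordinates_congr rfl rfl rfl rfl ?_
  rw [diff_eq_drmul_comp]
  ext v
  exact (hg _ (DFunLike.congr_fun (Jet.dprojModel_sub (j := σ.jet _ (B.toFiber g))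
    (k := τ.jet _ (B.toFiber g)) rfl) v)).symm

/-- The difference of two group connections, as a smooth cocycle on a fibre depending linearly on
a tangent vector of the base. -/
def diffCocycle (σ τ : B.GroupConnection) (x : M) : B.TBase x →ₗ[ℝ] B.Cocycle x where
  toFun v := ⟨fun g ↦ ⟨(diff σ τ g v : EG), DFunLike.congr_fun (dprojModel_comp_diff σ τ g) v⟩, by
    refine ⟨fun g₀ hg₀ ↦ ?_, fun g h ↦ DFunLike.congr_fun (diff_mul σ τ g h) v⟩
    let w : EM := v
    have h1 := ((smooth_diff σ τ g₀).clm_apply (contMDiffAt_const (c := w))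
      ).contMDiffWithinAt (s := B.proj ⁻¹' {x})
    -- Along one fibre both base points, `x` and the identity over it, are constant, so the tangent
    -- coordinates are the bare values.
    have h2 : ∀ g : G, B.proj g = x → Function.extend Subtype.val
        (fun g : B.Fiber x ↦ (diff σ τ g v : EG)) (fun _ ↦ 0) g =
        inTangentCoordinates 𝓘(ℝ, EM) 𝓘(ℝ, EG) B.proj (fun g ↦ B.one (B.proj g))
          (fun g ↦ diff σ τ (B.toFiber g)) g₀ g v := by
      rintro g rfl
      have hg₀' : B.proj g = B.proj g₀ := hg₀.symm
      rw [inTangentCoordinates_self hg₀' (congrArg B.one hg₀')]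
      exact Subtype.val_injective.extend_apply (fun g' : B.Fiber (B.proj g) ↦
        (diff σ τ g' v : EG)) _ (B.toFiber g)
    exact h1.congr (fun g hg ↦ h2 g hg) (h2 g₀ hg₀)⟩
  map_add' v w := Subtype.ext <| funext fun g ↦ Subtype.ext <| map_add (diff σ τ g) v w
  map_smul' c v := Subtype.ext <| funext fun g ↦ Subtype.ext <| map_smul (diff σ τ g) c v

/-- The difference of two group connections. -/
def difference (σ τ : B.GroupConnection) : B.CocycleForm :=
  ⟨diffCocycle σ τ, smooth_diff σ τ⟩

theorem jet_difference (σ τ : B.GroupConnection) (g : B.Fiber x) :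
    CocycleForm.jet (difference σ τ) g = σ.jet x g * (τ.jet x g)⁻¹ :=
  ofLie_diff σ τ g

/-- The affine structure on a nonempty space of group connections. -/
abbrev addTorsor (h : Nonempty B.GroupConnection) :
    AddTorsor B.CocycleForm B.GroupConnection where
  vadd := translate
  zero_vadd σ := ext_jet fun x g ↦ (jet_translate _ _ _).trans <| by
    rw [CocycleForm.jet_zero, one_mul]
  add_vadd θ η σ := ext_jet fun x g ↦ by
    change (translate (θ + η) σ).jet x g = (translate θ (translate η σ)).jet x g
    rw [jet_translate, jet_translate, jet_translate, CocycleForm.jet_add, mul_assoc]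
  vsub := difference
  nonempty := h
  vsub_vadd' σ τ := ext_jet fun x g ↦ by
    change (translate (difference σ τ) τ).jet x g = _
    rw [jet_translate, jet_difference, inv_mul_cancel_right]
  vadd_vsub' θ σ := CocycleForm.ext_eval fun x g ↦ by
    have h : CocycleForm.jet (difference (translate θ σ) σ) g = CocycleForm.jet θ g := by
      rw [jet_difference, jet_translate, mul_inv_cancel_right]
    -- Both jets have the form `d_x e + u`; cancel `d_x e`.
    exact add_left_cancel (congrArg Jet.lin h)

end GroupConnection

end GroupBundle

end

theorem theorem2p9
    {EM EG : Type*} [NormedAddCommGroup EM] [NormedSpace ℝ EM] [FiniteDimensional ℝ EM]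
    [NormedAddCommGroup EG] [NormedSpace ℝ EG] [FiniteDimensional ℝ EG]
    {M : Type*} [TopologicalSpace M] [T2Space M] [SigmaCompactSpace M]
    [ChartedSpace EM M] [IsManifold 𝓘(ℝ, EM) ∞ M]
    {G : Type*} [TopologicalSpace G] [ChartedSpace EG G] [IsManifold 𝓘(ℝ, EG) ∞ G]
    (B : GroupBundle EM EG M G) (hB : B.IsLocallyTrivial) :
    Nonempty B.GroupConnection ∧
    ∃ _ : AddTorsor B.CocycleForm B.GroupConnection,
      (∀ (θ : B.CocycleForm) (σ : B.GroupConnection) (x : M) (g : B.Fiber x) (v : B.TBase x),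
        B.vec ((θ +ᵥ σ) x g v) =
          B.vec (B.jetMul 1 g (B.jetOne x + B.evalAt (θ.1 x) g) (σ x g) v)) ∧
      (∀ (σ τ : B.GroupConnection) (x : M) (g : B.Fiber x) (v : B.TBase x),
        B.vec (B.evalAt ((σ -ᵥ τ).1 x) g v) =
          B.vec (B.jetMul g g⁻¹ (σ x g) (B.jetInv g (τ x g)) v) - B.vec (B.jetOne x v)) := by
  have h := hB.nonempty_groupConnection
  -- Both formulas hold by unfolding: the operations of `Jet x` have the same underlying linear maps
  -- as `jetMul`, `jetInv` and `jetOne`.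
  refine ⟨h, GroupBundle.GroupConnection.addTorsor h, fun θ σ x g v ↦ rfl, fun σ τ x g v ↦ rfl⟩
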